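/- Let $H:\mathbb R\to\mathbb R$ be a smooth, nonnegative, even function with $xH'(x)<0$ for $0<|x|<1$, $xH'(x)>0$ for $|x|>1$, $H(\pm1)=H'(\pm1)=H'(0)=0$, $H(0)=H(\pm2)=1$ and $H''(0)<0<H''(\pm1)$. Put $\tau_\varepsilon=\varepsilon^{-2}e^{-1/\varepsilon^2}$ and $k=\pi^{-1}\sqrt{|H''(0)|\,H''(1)}$. Let $\varepsilon_0>0$ be such that $Z_\varepsilon=\int_{\mathbb R}e^{-H(y)/\varepsilon^2}\,dy<\infty$ for all $\varepsilon\in(0,\varepsilon_0)$, and put $\gamma_\varepsilon=Z_\varepsilon^{-1}e^{-H/\varepsilon^2}$. For each $\varepsilon\in(0,\varepsilon_0)$ let $\rho_\varepsilon:[0,\infty)\times\mathbb R\to[0,\infty)$, with $\rho_\varepsilon(t,\cdot)$ a probability density for every $t\ge0$, be a classical solution ($C^1$ in $t$ and $C^2$ in $x$ for $t>0$) of the rescaled Kramers–Smoluchowski equation $$\tau_\varepsilon\,\partial_t\rho_\varepsilon=\partial_x\big(\partial_x\rho_\varepsilon+\varepsilon^{-2}\rho_\varepsilon H'\big),\qquad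 x\in\mathbb R,\ t>0,$$ with initial datum $\rho_\varepsilon(0,\cdot)=\rho_\varepsilon^0$, attained in the weak$\star$ sense of probability measures as $t\downarrow0$. Suppose that the probability measures $\rho_\varepsilon^0\,dx$ converge weakly$\star$ to a probability measure $\rho^0$ on $\mathbb R$ as $\varepsilon\to0$, and that $u_\varepsilon^0=\rho_\varepsilon^0/\gamma_\varepsilon$ has a weak derivative and satisfies $$\int_{\mathbb R}\gamma_\varepsilon|u_\varepsilon^0|^2\,dx+\int_{\mathbb R}\frac{\gamma_\varepsilon|\partial_xu_\varepsilon^0|^2}{\tau_\varepsilon}\,dx\le C,\qquad u_\varepsilon^0(x)\ge c>0\quad\text{for all }x\in\mathbb R,$$ with constants $C$ and $c$ independent of $\varepsilon$. Then, for all $t\ge0$, $$\rho_\varepsilon(t,\cdot)\,dx\ \longrightarrow\ \tfrac12\big(u(t)\,\delta_{+1}+(2-u(t))\,\delta_{-1}\big)\qquad\text{as }\varepsilon\to0$$ weakly$\star$ in the space of probability measures, where $u:[0,\infty)\to[0,2]$ satisfies $\dot u=-k(u-1)$ and $u(0)=2\rho^0((0,\infty))$. -/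

import Mathlib

open MeasureTheory Filter Topology Set
open scoped ContDiff

noncomputable section

namespace Kramers

/-- A typical double-well enthalpy function with wells at `±1` and barrier of height one
at `0`. -/
structure IsDoubleWell (H : ℝ → ℝ) : Prop where
  smooth : ContDiff ℝ ∞ H
  nonneg : ∀ x, 0 ≤ H x
  even : Function.Even H
  deriv_inner : ∀ x, 0 < |x| → |x| < 1 → x * deriv H x < 0
  deriv_outer : ∀ x, 1 < |x| → 0 < x * deriv H x
  well : H 1 = 0 ∧ H (-1) = 0
  deriv_well : deriv H 1 = 0 ∧ deriv H (-1) = 0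
  deriv_barrier : deriv H 0 = 0
  barrier : H 0 = 1
  at_two : H 2 = 1 ∧ H (-2) = 1
  deriv2_barrier : deriv (deriv H) 0 < 0
  deriv2_well : 0 < deriv (deriv H) 1 ∧ 0 < deriv (deriv H) (-1)

/-- The time scale `τ_ε = ε⁻² e^{-1/ε²}`. -/
def tau (ε : ℝ) : ℝ := (ε ^ 2)⁻¹ * Real.exp (-1 / ε ^ 2)

/-- Kramers' constant `k = π⁻¹ √(|H''(0)| H''(1))`. -/
def rate (H : ℝ → ℝ) : ℝ :=
  Real.pi⁻¹ * Real.sqrt (|deriv (deriv H) 0| * deriv (deriv H) 1)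

/-- The normalization constant `Z_ε = ∫ e^{-H/ε²}`. -/
def partitionFn (H : ℝ → ℝ) (ε : ℝ) : ℝ := ∫ y, Real.exp (-H y / ε ^ 2)

/-- The density `γ_ε = Z_ε⁻¹ e^{-H/ε²}` of the invariant measure. -/
def gam (H : ℝ → ℝ) (ε : ℝ) (x : ℝ) : ℝ :=
  (partitionFn H ε)⁻¹ * Real.exp (-H x / ε ^ 2)

/-- Probability densities on the real line. -/
structure ProbDensity where
  /-- the density as a function -/
  toFun : ℝ → ℝ
  nonneg : ∀ x, 0 ≤ toFun x
  integrable : Integrable toFun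
  integral_eq_one : ∫ x, toFun x = 1

instance : CoeFun ProbDensity (fun _ => ℝ → ℝ) := ⟨ProbDensity.toFun⟩

/-- The probability measure `ρ dx` with density `ρ`. -/
def ProbDensity.law (ρ : ProbDensity) : ProbabilityMeasure ℝ :=
  ⟨volume.withDensity (fun x => ENNReal.ofReal (ρ x)), ⟨by
    rw [withDensity_apply _ MeasurableSet.univ, Measure.restrict_univ,
      ← ofReal_integral_eq_lintegral_ofReal ρ.integrable (ae_of_all _ ρ.nonneg),
      ρ.integral_eq_one, ENNReal.ofReal_one]⟩⟩

/-- `g` is the weak (distributional) derivative of `f` on the real line. -/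
def HasWeakDeriv (f g : ℝ → ℝ) : Prop :=
  LocallyIntegrable f ∧ LocallyIntegrable g ∧
    ∀ φ : ℝ → ℝ, ContDiff ℝ ∞ φ → HasCompactSupport φ →
      ∫ x, f x * deriv φ x = -∫ x, g x * φ x

/-- `ρ` is a classical solution (`C¹` in time and `C²` in space for positive times), within the
probability densities, of the rescaled Kramers–Smoluchowski equation
`τ_ε ∂ₜρ = ∂ₓ(∂ₓρ + ε⁻² ρ H')` on `(0,∞) × ℝ`, and it attains its initial datum `ρ₀` in the
weak-star sense as `t ↓ 0`. Only the times `t ≥ 0` matter. -/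
structure IsSolution (H : ℝ → ℝ) (ε : ℝ) (ρ : ℝ → ProbDensity) (ρ₀ : ProbDensity) : Prop where
  contDiff_space : ∀ t, 0 < t → ContDiff ℝ 2 (ρ t)
  differentiable_time : ∀ t, 0 < t → ∀ x, DifferentiableAt ℝ (fun s => ρ s x) t
  continuousOn : ContinuousOn (fun p : ℝ × ℝ => ρ p.1 p.2) (Ioi 0 ×ˢ univ)
  continuousOn_dt :
    ContinuousOn (fun p : ℝ × ℝ => deriv (fun s => ρ s p.2) p.1) (Ioi 0 ×ˢ univ)
  continuousOn_dx : ContinuousOn (fun p : ℝ × ℝ => deriv (ρ p.1) p.2) (Ioi 0 ×ˢ univ)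
  continuousOn_dxx :
    ContinuousOn (fun p : ℝ × ℝ => deriv (deriv (ρ p.1)) p.2) (Ioi 0 ×ˢ univ)
  equation : ∀ t, 0 < t → ∀ x,
    tau ε * deriv (fun s => ρ s x) t =
      deriv (fun y => deriv (ρ t) y + (ε ^ 2)⁻¹ * ρ t y * deriv H y) x
  initial : ρ 0 = ρ₀
  attained : Tendsto (fun t => (ρ t).law) (𝓝[>] 0) (𝓝 ρ₀.law)

/-- Well-preparedness of the initial datum `ρ₀`, where `u₀ = ρ₀ / γ_ε`:
`∫ γ_ε |u₀|² + ∫ γ_ε |∂ₓu₀|² / τ_ε ≤ C` and `u₀ ≥ c`. -/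
structure IsWellPrepared (H : ℝ → ℝ) (ε C c : ℝ) (ρ₀ : ProbDensity) : Prop where
  energy : ∃ du : ℝ → ℝ, HasWeakDeriv (fun x => ρ₀ x / gam H ε x) du ∧
    Integrable (fun x => gam H ε x * (ρ₀ x / gam H ε x) ^ 2) ∧
    Integrable (fun x => gam H ε x * du x ^ 2 / tau ε) ∧
    (∫ x, gam H ε x * (ρ₀ x / gam H ε x) ^ 2) + (∫ x, gam H ε x * du x ^ 2 / tau ε) ≤ C
  lower : ∀ x, c ≤ ρ₀ x / gam H ε x

end Kramers

end

/-
For small `ε` the law of `ρ_ε t` sits near the wells: this holds at time `0` and propagates by a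
Lyapunov function whose growth is cut off through one-sided test functions, since `H'` may grow
arbitrarily fast. So only the difference of the two well masses is left to compute. Let `g` be a
compactly supported odd function, equal to `±1` near `±1`, and solve `L f = -r_ε g` explicitly,
where `L f = τ_ε⁻¹ (f'' - ε⁻² H' f')` is the generator and `r_ε` normalises `f` to `1` at `1 / 2`.
The solution `f` stays flat away from the barrier, hence `f ≈ g` near the wells and `f` is an
approximate eigenfunction: `∫ f dρ_ε` decays like `e^{-r_ε t}`. Laplace asymptotics of the well
mass and of the barrier mass give `r_ε → k`.
-/

namespace Kramers

section Calculus

theorem contDiff_two_of_hasDerivAt {f f₁ f₂ : ℝ → ℝ} (h₁ : ∀ x, HasDerivAt f (f₁ x) x)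
    (h₂ : ∀ x, HasDerivAt f₁ (f₂ x) x) (hf₂ : Continuous f₂) : ContDiff ℝ 2 f := by
  have e₁ : deriv f = f₁ := funext fun x => (h₁ x).deriv
  have e₂ : deriv f₁ = f₂ := funext fun x => (h₂ x).deriv
  rw [← one_add_one_eq_two, contDiff_succ_iff_deriv, e₁, contDiff_one_iff_deriv, e₂]
  exact ⟨fun x => (h₁ x).differentiableAt, by simp, fun x => (h₂ x).differentiableAt, hf₂⟩

theorem contDiff_one_deriv {f : ℝ → ℝ} (hf : ContDiff ℝ 2 f) : ContDiff ℝ 1 (deriv f) :=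
  (contDiff_succ_iff_deriv.1 (one_add_one_eq_two (R := WithTop ℕ∞) ▸ hf)).2.2

theorem hasDerivAt_max_zero_pow (n : ℕ) (y : ℝ) :
    HasDerivAt (fun y : ℝ => max y 0 ^ (n + 2)) ((n + 2 : ℝ) * max y 0 ^ (n + 1)) y := by
  rcases lt_trichotomy y 0 with hy | rfl | hy
  · have h : (fun y : ℝ => max y 0 ^ (n + 2)) =ᶠ[𝓝 y] fun _ => 0 := by
      filter_upwards [gt_mem_nhds hy] with z hz
      simp [hz.le]
    simpa [hy.le] using (hasDerivAt_const y (0 : ℝ)).congr_of_eventuallyEq h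
  · have h : (fun y : ℝ => max y 0 ^ (n + 2)) =O[𝓝 0] fun y => ‖y - 0‖ ^ (n + 2) := by
      refine Asymptotics.isBigO_of_le _ fun y => ?_
      have hy : |max y 0| ≤ |y| := by
        rw [abs_of_nonneg (le_max_right y 0)]
        exact max_le (le_abs_self y) (abs_nonneg y)
      simpa using pow_le_pow_left₀ (abs_nonneg _) hy (n + 2)
    simpa using (h.hasFDerivAt (by omega)).hasDerivAt
  · have h : (fun y : ℝ => max y 0 ^ (n + 2)) =ᶠ[𝓝 y] fun z => z ^ (n + 2) := by
      filter_upwards [lt_mem_nhds hy] with z hz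
      rw [max_eq_left hz.le]
    simpa [hy.le] using (hasDerivAt_pow (n + 2) y).congr_of_eventuallyEq h

theorem le_of_hasDerivAt_nonpos {z z' : ℝ → ℝ} {z₀ T : ℝ} (hT : 0 < T)
    (hz : ∀ t ∈ Ioc 0 T, HasDerivAt z (z' t) t) (h₀ : Tendsto z (𝓝[>] 0) (𝓝 z₀))
    (h : ∀ t ∈ Ioc 0 T, z' t ≤ 0) : z T ≤ z₀ := by
  have anti : AntitoneOn z (Ioc 0 T) := by
    refine antitoneOn_of_hasDerivWithinAt_nonpos (f' := z') (convex_Ioc 0 T)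
      (fun t ht => (hz t ht).continuousAt.continuousWithinAt)
      (fun t ht => (hz t (interior_subset ht)).hasDerivWithinAt)
      fun t ht => h t (interior_subset ht)
  refine ge_of_tendsto h₀ ?_
  filter_upwards [Ioc_mem_nhdsGT hT] with s hs
  exact anti hs ⟨hT, le_rfl⟩ hs.2

theorem le_add_exp_neg_mul_of_hasDerivAt_le {y y' : ℝ → ℝ} {y₀ Λ b T : ℝ} (hT : 0 < T)
    (hy : ∀ t ∈ Ioc 0 T, HasDerivAt y (y' t) t) (h₀ : Tendsto y (𝓝[>] 0) (𝓝 y₀))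
    (h : ∀ t ∈ Ioc 0 T, y' t ≤ Λ * (b - y t)) :
    y T ≤ b + Real.exp (-(Λ * T)) * (y₀ - b) := by
  have key : Real.exp (Λ * T) * (y T - b) ≤ y₀ - b := by
    refine le_of_hasDerivAt_nonpos (z := fun t => Real.exp (Λ * t) * (y t - b))
      (z' := fun t => Real.exp (Λ * t) * (y' t - Λ * (b - y t))) hT (fun t ht => ?_) ?_
      fun t ht => mul_nonpos_of_nonneg_of_nonpos (Real.exp_nonneg _) (by linarith [h t ht])
    · refine ((((hasDerivAt_id t).const_mul Λ).exp).mul ((hy t ht).sub_const b)).congr_deriv ?_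
      simp only [id, mul_one]
      ring
    · have hexp : Continuous fun t : ℝ => Real.exp (Λ * t) := by fun_prop
      simpa using ((hexp.tendsto 0).mono_left nhdsWithin_le_nhds).mul (h₀.sub_const b)
  have := mul_le_mul_of_nonneg_left key (Real.exp_nonneg (-(Λ * T)))
  rw [← mul_assoc, ← Real.exp_add, neg_add_cancel, Real.exp_zero, one_mul] at this
  linarith

theorem abs_sub_exp_neg_mul_le {y z : ℝ → ℝ} {y₀ r e T : ℝ} (hT : 0 < T) (hr : 0 ≤ r)
    (hy : ∀ t ∈ Ioc 0 T, HasDerivAt y (-(r * z t)) t) (h₀ : Tendsto y (𝓝[>] 0) (𝓝 y₀))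
    (h : ∀ t ∈ Ioc 0 T, |y t - z t| ≤ e) : |y T - Real.exp (-(r * T)) * y₀| ≤ e := by
  have he : 0 ≤ Real.exp (-(r * T)) * e :=
    mul_nonneg (Real.exp_nonneg _) ((abs_nonneg _).trans (h T ⟨hT, le_rfl⟩))
  have upper := le_add_exp_neg_mul_of_hasDerivAt_le (Λ := r) (b := e) hT hy h₀ fun t ht => by
    nlinarith [(abs_le.1 (h t ht)).2]
  have lower := le_add_exp_neg_mul_of_hasDerivAt_le (Λ := r) (b := e) hT
    (fun t ht => (hy t ht).neg) h₀.neg fun t ht => by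
      simp only [Pi.neg_apply]
      nlinarith [(abs_le.1 (h t ht)).1]
  simp only [Pi.neg_apply] at lower
  exact abs_le.2 ⟨by linarith, by linarith⟩

end Calculus

/-- The backward generator `f ↦ τ_ε⁻¹ (f'' - ε⁻² H' f')`, the formal adjoint of the right-hand
side of the rescaled Kramers–Smoluchowski equation. -/
noncomputable def gen (H : ℝ → ℝ) (ε : ℝ) (f : ℝ → ℝ) (x : ℝ) : ℝ :=
  (tau ε)⁻¹ * (deriv (deriv f) x - (ε ^ 2)⁻¹ * deriv H x * deriv f x)

/-- Test functions for the weak form of the equation: functions of class `C²` that are locally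
constant outside a compact set. -/
structure IsTestFn (f : ℝ → ℝ) : Prop where
  contDiff : ContDiff ℝ 2 f
  hasCompactSupport_deriv : HasCompactSupport (deriv f)

theorem tau_pos {ε : ℝ} (hε : 0 < ε) : 0 < tau ε := by
  unfold tau
  positivity

namespace IsDoubleWell

variable {H : ℝ → ℝ} (hH : IsDoubleWell H)
include hH

theorem continuous : Continuous H := hH.smooth.continuous

theorem contDiff_deriv : ContDiff ℝ ∞ (deriv H) := (contDiff_infty_iff_deriv.1 hH.smooth).2

theorem hasDerivAt (x : ℝ) : HasDerivAt H (deriv H x) x :=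
  (hH.smooth.differentiable (by simp) x).hasDerivAt

theorem hasDerivAt_deriv (x : ℝ) : HasDerivAt (deriv H) (deriv (deriv H) x) x :=
  (hH.contDiff_deriv.differentiable (by simp) x).hasDerivAt

theorem continuous_deriv : Continuous (deriv H) := hH.contDiff_deriv.continuous

theorem continuous_deriv_deriv : Continuous (deriv (deriv H)) :=
  (contDiff_infty_iff_deriv.1 hH.contDiff_deriv).2.continuous

theorem continuous_gen (ε : ℝ) {f : ℝ → ℝ} (hf : ContDiff ℝ 2 f) : Continuous (gen H ε f) := by
  have h₁ := contDiff_one_deriv hf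
  have h₁c := h₁.continuous
  have := h₁.continuous_deriv le_rfl
  have hHc := hH.continuous_deriv
  unfold gen
  fun_prop

end IsDoubleWell

section Generator

variable (H : ℝ → ℝ) (ε : ℝ) (f : ℝ → ℝ)

theorem gen_const_add (c : ℝ) : gen H ε (fun x => c + f x) = gen H ε f := by
  ext x
  simp only [gen, deriv_const_add']

theorem gen_const_sub (c : ℝ) : gen H ε (fun x => c - f x) = fun x => -gen H ε f x := by
  ext x
  simp only [gen, deriv_const_sub', deriv.fun_neg']
  ring

variable {f}

theorem hasCompactSupport_gen (hf : HasCompactSupport (deriv f)) :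
    HasCompactSupport (gen H ε f) :=
  (hf.deriv.sub hf.mul_left).mul_left

end Generator

theorem integral_mul_eq_neg_integral_mul_deriv {u u' q : ℝ → ℝ}
    (hu : ∀ x, HasDerivAt u (u' x) x) (hu' : Continuous u') (hq : ContDiff ℝ 1 q)
    (hqs : HasCompactSupport q) : ∫ x, u' x * q x = -∫ x, u x * deriv q x := by
  have hu₀ : Continuous u := continuous_iff_continuousAt.2 fun x => (hu x).continuousAt
  have hq' := hq.continuous_deriv le_rfl
  have parts := integral_mul_deriv_eq_deriv_mul_of_integrable (fun x _ => hu x)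
    (fun x _ => (hq.differentiable one_ne_zero x).hasDerivAt)
    ((hu₀.mul hq').integrable_of_hasCompactSupport hqs.deriv.mul_left)
    ((hu'.mul hq.continuous).integrable_of_hasCompactSupport hqs.mul_left)
    ((hu₀.mul hq.continuous).integrable_of_hasCompactSupport hqs.mul_left)
  rw [parts, neg_neg]

namespace ProbDensity

variable (ρ : ProbDensity)

theorem integral_law (φ : ℝ → ℝ) : ∫ x, φ x ∂(ρ.law : Measure ℝ) = ∫ x, ρ x * φ x := by
  change ∫ x, φ x ∂(volume.withDensity fun x => ENNReal.ofReal (ρ x)) = _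
  rw [integral_withDensity_eq_integral_toReal_smul₀ ρ.integrable.aemeasurable.ennreal_ofReal
    (ae_of_all _ fun _ => ENNReal.ofReal_lt_top)]
  congr 1 with x
  rw [ENNReal.toReal_ofReal (ρ.nonneg x), smul_eq_mul]

end ProbDensity

namespace IsSolution

variable {H : ℝ → ℝ} {ε : ℝ} {ρ : ℝ → ProbDensity} {ρ₀ : ProbDensity}
  (hρ : IsSolution H ε ρ ρ₀) {q : ℝ → ℝ}
include hρ

theorem continuous_time_deriv {t : ℝ} (ht : 0 < t) :
    Continuous fun x => deriv (fun s => ρ s x) t :=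
  continuousOn_univ.1 <| hρ.continuousOn_dt.comp (f := fun x : ℝ => (t, x)) (by fun_prop)
    fun x _ => ⟨ht, mem_univ x⟩

theorem hasDerivAt_integral_mul (hq : Continuous q) (hqs : HasCompactSupport q) {t : ℝ}
    (ht : 0 < t) :
    HasDerivAt (fun s => ∫ x, ρ s x * q x) (∫ x, deriv (fun s => ρ s x) t * q x) t := by
  have hpos : ∀ s ∈ Icc (t / 2) (2 * t), 0 < s := fun s hs => (half_pos ht).trans_le hs.1
  have hprod : ContinuousOn (fun p : ℝ × ℝ => deriv (fun s => ρ s p.2) p.1 * q p.2)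
      (Ioi 0 ×ˢ univ) := hρ.continuousOn_dt.mul (hq.comp continuous_snd).continuousOn
  obtain ⟨B, hB⟩ := (isCompact_Icc.prod hqs.isCompact).exists_bound_of_continuousOn
    (hprod.mono (prod_mono hpos (subset_univ (tsupport q))))
  have hslice : ∀ s, 0 < s → Continuous fun x => ρ s x * q x := fun s hs =>
    (hρ.contDiff_space s hs).continuous.mul hq
  refine (hasDerivAt_integral_of_dominated_loc_of_deriv_le (μ := volume)
    (F := fun s x => ρ s x * q x) (F' := fun s x => deriv (fun s => ρ s x) s * q x)
    (bound := (tsupport q).indicator fun _ => B)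
    (Icc_mem_nhds (half_lt_self ht) (by linarith : t < 2 * t)) ?_ ?_ ?_ ?_ ?_ ?_).2
  · filter_upwards [lt_mem_nhds ht] with s hs
    exact (hslice s hs).aestronglyMeasurable
  · exact (hslice t ht).integrable_of_hasCompactSupport hqs.mul_left
  · exact ((hρ.continuous_time_deriv ht).mul hq).aestronglyMeasurable
  · refine ae_of_all _ fun x s hs => ?_
    by_cases hx : x ∈ tsupport q
    · rw [indicator_of_mem hx]
      exact hB (s, x) ⟨hs, hx⟩
    · rw [indicator_of_notMem hx, image_eq_zero_of_notMem_tsupport hx, mul_zero, norm_zero]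
  · rw [integrable_indicator_iff (isClosed_tsupport q).measurableSet]
    exact integrableOn_const hqs.isCompact.measure_ne_top
  · exact ae_of_all _ fun x s hs =>
      (hρ.differentiable_time s (hpos s hs) x).hasDerivAt.mul_const _

theorem hasDerivAt_flux (hH : IsDoubleWell H) {t : ℝ} (ht : 0 < t) (x : ℝ) :
    HasDerivAt (fun y => deriv (ρ t) y + (ε ^ 2)⁻¹ * ρ t y * deriv H y)
      (tau ε * deriv (fun s => ρ s x) t) x := by
  rw [hρ.equation t ht x]
  have h₀ := (hρ.contDiff_space t ht).differentiable two_ne_zero x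
  have h₁ := (contDiff_one_deriv (hρ.contDiff_space t ht)).differentiable one_ne_zero x
  exact (h₁.add ((h₀.const_mul _).mul (hH.hasDerivAt_deriv x).differentiableAt)).hasDerivAt

theorem integral_time_deriv_mul (hH : IsDoubleWell H) (hε : 0 < ε) (hq : ContDiff ℝ 2 q)
    (hqs : HasCompactSupport q) {t : ℝ} (ht : 0 < t) :
    ∫ x, deriv (fun s => ρ s x) t * q x = ∫ x, ρ t x * gen H ε q x := by
  have hρ₀ := hρ.contDiff_space t ht
  have hρ₁ := contDiff_one_deriv hρ₀
  have hq₁ := contDiff_one_deriv hq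
  have cρ₀ := hρ₀.continuous
  have cρ₁ := hρ₁.continuous
  have cH := hH.continuous_deriv
  have ibp₁ := integral_mul_eq_neg_integral_mul_deriv (hρ.hasDerivAt_flux hH ht)
    (continuous_const.mul (hρ.continuous_time_deriv ht)) (hq.of_le one_le_two) hqs
  have ibp₂ := integral_mul_eq_neg_integral_mul_deriv
    (fun x => (hρ₀.differentiable two_ne_zero x).hasDerivAt) cρ₁ hq₁ hqs.deriv
  have int₁ : Integrable fun x => deriv (ρ t) x * deriv q x :=
    (cρ₁.mul hq₁.continuous).integrable_of_hasCompactSupport hqs.deriv.mul_left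
  have int₂ : Integrable fun x => (ε ^ 2)⁻¹ * ρ t x * deriv H x * deriv q x :=
    (((continuous_const.mul cρ₀).mul cH).mul hq₁.continuous).integrable_of_hasCompactSupport
      hqs.deriv.mul_left
  have int₃ : Integrable fun x => ρ t x * deriv (deriv q) x :=
    (cρ₀.mul (hq₁.continuous_deriv le_rfl)).integrable_of_hasCompactSupport hqs.deriv.deriv.mul_left
  calc ∫ x, deriv (fun s => ρ s x) t * q x
      = (tau ε)⁻¹ * ∫ x, tau ε * deriv (fun s => ρ s x) t * q x := by
        simp_rw [mul_assoc, integral_const_mul]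
        rw [inv_mul_cancel_left₀ (tau_pos hε).ne']
    _ = (tau ε)⁻¹ * ((∫ x, ρ t x * deriv (deriv q) x) -
          ∫ x, (ε ^ 2)⁻¹ * ρ t x * deriv H x * deriv q x) := by
        rw [ibp₁]
        simp_rw [add_mul]
        rw [integral_add int₁ int₂, ibp₂]
        ring
    _ = ∫ x, ρ t x * gen H ε q x := by
        rw [← integral_sub int₃ int₂, ← integral_const_mul]
        congr 1 with x
        unfold gen
        ring

theorem hasDerivAt_integral_law_of_hasCompactSupport (hH : IsDoubleWell H) (hε : 0 < ε)
    (hq : ContDiff ℝ 2 q) (hqs : HasCompactSupport q) {t : ℝ} (ht : 0 < t) :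
    HasDerivAt (fun s => ∫ x, q x ∂((ρ s).law : Measure ℝ))
      (∫ x, gen H ε q x ∂((ρ t).law : Measure ℝ)) t := by
  simp_rw [ProbDensity.integral_law]
  rw [← hρ.integral_time_deriv_mul hH hε hq hqs ht]
  exact hρ.hasDerivAt_integral_mul hq.continuous hqs ht

theorem continuousOn_integral_law (hq : Continuous q) (hqs : HasCompactSupport q) :
    ContinuousOn (fun t => ∫ x, q x ∂((ρ t).law : Measure ℝ)) (Ioi 0) := by
  simp_rw [ProbDensity.integral_law]
  refine continuousOn_integral_of_compact_support (f := fun t x => ρ t x * q x) hqs.isCompact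
    (hρ.continuousOn.mul (hq.comp continuous_snd).continuousOn) fun t x _ hx => ?_
  rw [image_eq_zero_of_notMem_tsupport hx, mul_zero]

theorem tendsto_integral_law {F : ℝ} (hq : Continuous q) (hF : ∀ x, |q x| ≤ F) :
    Tendsto (fun t => ∫ x, q x ∂((ρ t).law : Measure ℝ)) (𝓝[>] 0)
      (𝓝 (∫ x, q x ∂(ρ₀.law : Measure ℝ))) :=
  ProbabilityMeasure.tendsto_iff_forall_integral_tendsto.1 hρ.attained
    (BoundedContinuousFunction.ofNormedAddCommGroup q hq F hF)

end IsSolution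

namespace IsTestFn

variable {f : ℝ → ℝ} (hf : IsTestFn f)
include hf

theorem exists_abs_le : ∃ F, ∀ x, |f x| ≤ F := by
  have hf' := contDiff_one_deriv hf.contDiff
  refine ⟨|f 0| + ∫ y, |deriv f y|, fun x => ?_⟩
  have h : |f x - f 0| ≤ ∫ y, |deriv f y| := by
    rw [← intervalIntegral.integral_deriv_eq_sub
      (fun y _ => hf.contDiff.differentiable two_ne_zero y) (hf'.continuous.intervalIntegrable 0 x)]
    exact intervalIntegral.norm_integral_le_integral_norm_uIoc.trans <|
      setIntegral_le_integral
        (hf'.continuous.integrable_of_hasCompactSupport hf.hasCompactSupport_deriv).norm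
        (ae_of_all _ fun y => norm_nonneg _)
  linarith [abs_sub_abs_le_abs_sub (f x) (f 0)]

theorem const_add (c : ℝ) : IsTestFn fun x => c + f x where
  contDiff := contDiff_const.add hf.contDiff
  hasCompactSupport_deriv := by simpa using hf.hasCompactSupport_deriv

theorem const_sub (c : ℝ) : IsTestFn fun x => c - f x where
  contDiff := contDiff_const.sub hf.contDiff
  hasCompactSupport_deriv := by
    simp only [deriv_const_sub']
    exact hf.hasCompactSupport_deriv.neg

end IsTestFn

theorem gen_mul {f g : ℝ → ℝ} (H : ℝ → ℝ) (ε : ℝ) (hf : ContDiff ℝ 2 f) (hg : ContDiff ℝ 2 g)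
    (x : ℝ) : gen H ε (fun y => f y * g y) x =
      f x * gen H ε g x + g x * gen H ε f x + 2 * (tau ε)⁻¹ * (deriv f x * deriv g x) := by
  have df := fun y => hf.differentiable two_ne_zero y
  have dg := fun y => hg.differentiable two_ne_zero y
  have df' := (contDiff_one_deriv hf).differentiable one_ne_zero x
  have dg' := (contDiff_one_deriv hg).differentiable one_ne_zero x
  have e : deriv (fun y => f y * g y) = fun y => deriv f y * g y + f y * deriv g y :=
    funext fun y => deriv_fun_mul (df y) (dg y)
  have e' : deriv (fun y => deriv f y * g y + f y * deriv g y) x = _ :=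
    ((df'.hasDerivAt.mul (dg x).hasDerivAt).add ((df x).hasDerivAt.mul dg'.hasDerivAt)).deriv
  unfold gen
  rw [e, e']
  ring

section Cutoff

/-- A smooth even bump function, equal to one on `[-1, 1]` and nonincreasing in `|x|`; its dilations
`bump (x / n)` cut off test functions near infinity. -/
noncomputable def bump (x : ℝ) : ℝ := Real.smoothTransition (2 - x ^ 2)

theorem contDiff_bump : ContDiff ℝ 2 bump :=
  Real.smoothTransition.contDiff.comp (contDiff_const.sub (contDiff_id.pow 2))

theorem bump_nonneg (x : ℝ) : 0 ≤ bump x := Real.smoothTransition.nonneg _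

theorem bump_le_one (x : ℝ) : bump x ≤ 1 := Real.smoothTransition.le_one _

theorem bump_eq_one {x : ℝ} (hx : |x| ≤ 1) : bump x = 1 :=
  Real.smoothTransition.one_of_one_le (by linarith [(sq_le_one_iff_abs_le_one x).2 hx])

theorem hasCompactSupport_bump : HasCompactSupport bump := by
  refine HasCompactSupport.intro (isCompact_Icc (a := -2) (b := 2)) fun x hx => ?_
  have hx' : 2 < |x| := not_le.1 fun h => hx (abs_le.1 h)
  exact Real.smoothTransition.zero_of_nonpos (by nlinarith [sq_abs x])

theorem mul_deriv_bump_nonpos (x : ℝ) : x * deriv bump x ≤ 0 := by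
  have h : HasDerivAt bump (deriv Real.smoothTransition (2 - x ^ 2) * -(2 * x)) x := by
    have inner : HasDerivAt (fun y : ℝ => 2 - y ^ 2) (-(2 * x)) x := by
      simpa using (hasDerivAt_pow 2 x).const_sub 2
    exact (((Real.smoothTransition.contDiff (n := 1)).differentiable one_ne_zero
      (2 - x ^ 2)).hasDerivAt).comp x inner
  rw [h.deriv]
  nlinarith [mul_nonneg (Real.smoothTransition.monotone.deriv_nonneg (x := 2 - x ^ 2))
    (sq_nonneg x)]

theorem deriv_bump_comp_mul (a : ℝ) :
    deriv (fun x => bump (a * x)) = fun x => a * deriv bump (a * x) :=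
  funext fun x => deriv_comp_mul_left a bump x

theorem deriv_deriv_bump_comp_mul (a x : ℝ) :
    deriv (deriv fun x => bump (a * x)) x = a ^ 2 * deriv (deriv bump) (a * x) := by
  rw [deriv_bump_comp_mul, deriv_const_mul_field, deriv_comp_mul_left, smul_eq_mul]
  ring

theorem tendsto_bump_div_natCast (x : ℝ) :
    Tendsto (fun n : ℕ => bump ((n : ℝ)⁻¹ * x)) atTop (𝓝 1) := by
  have h : Tendsto (fun n : ℕ => (n : ℝ)⁻¹ * x) atTop (𝓝 0) := by
    simpa using tendsto_inv_atTop_nhds_zero_nat.mul_const x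
  simpa [bump_eq_one, Function.comp_def] using (contDiff_bump.continuous.tendsto 0).comp h

theorem gen_mul_bump_eq (H : ℝ → ℝ) (ε : ℝ) (p : ℝ → ℝ) {a x : ℝ} (hx : |a * x| < 1) :
    gen H ε (fun y => p y * bump (a * y)) x = gen H ε p x := by
  have h : (fun y => p y * bump (a * y)) =ᶠ[𝓝 x] p := by
    have hcont : ContinuousAt (fun y => |a * y|) x := by fun_prop
    filter_upwards [hcont.eventually (gt_mem_nhds hx)] with y hy
    rw [bump_eq_one hy.le, mul_one]
  rw [gen, gen, h.deriv_eq, h.deriv.deriv_eq]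

theorem hasCompactSupport_bump_comp_mul {a : ℝ} (ha : a ≠ 0) :
    HasCompactSupport fun x => bump (a * x) :=
  hasCompactSupport_bump.comp_homeomorph (Homeomorph.mulLeft₀ a ha)

end Cutoff

namespace IsDoubleWell

variable {H : ℝ → ℝ} (hH : IsDoubleWell H)
include hH

theorem mul_deriv_nonneg {x : ℝ} (hx : 1 ≤ |x|) : 0 ≤ x * deriv H x := by
  rcases hx.lt_or_eq with h | h
  · exact (hH.deriv_outer x h).le
  · rcases eq_or_eq_neg_of_abs_eq h.symm with rfl | rfl <;> simp [hH.deriv_well]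

theorem exists_gen_bump_ge {ε : ℝ} (hε : 0 < ε) :
    ∃ B, 0 ≤ B ∧ ∀ a x, 1 ≤ |x| → -(B * a ^ 2) ≤ gen H ε (fun y => bump (a * y)) x := by
  obtain ⟨B, hB⟩ := hasCompactSupport_bump.deriv.deriv.exists_bound_of_continuous
    ((contDiff_one_deriv contDiff_bump).continuous_deriv le_rfl)
  have hτ := inv_pos.2 (tau_pos hε)
  have hB₀ : 0 ≤ B := (norm_nonneg _).trans (hB 0)
  refine ⟨(tau ε)⁻¹ * B, by positivity, fun a x hx => ?_⟩
  have drift : deriv H x * (a * deriv bump (a * x)) ≤ 0 := by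
    have hx₀ : 0 < x ^ 2 := by nlinarith [sq_abs x]
    have h := mul_nonpos_of_nonneg_of_nonpos (hH.mul_deriv_nonneg hx)
      (mul_deriv_bump_nonpos (a * x))
    exact nonpos_of_mul_nonpos_right (by linarith : x ^ 2 * _ ≤ 0) hx₀
  have diffusion := mul_le_mul_of_nonneg_left (abs_le.1 (hB (a * x))).1 (sq_nonneg a)
  have hε₂ : 0 ≤ (ε ^ 2)⁻¹ := by positivity
  rw [gen, deriv_deriv_bump_comp_mul, deriv_bump_comp_mul, mul_assoc (ε ^ 2)⁻¹,
    show -((tau ε)⁻¹ * B * a ^ 2) = (tau ε)⁻¹ * (a ^ 2 * -B) by ring]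
  gcongr
  linarith [mul_nonpos_of_nonneg_of_nonpos hε₂ drift]

/-- Since `x H'(x) ≥ 0` for `|x| ≥ 1`, the drift acting on the cutoff has a favourable sign, however
fast `H'` grows. -/
theorem exists_gen_mul_bump_ge {ε : ℝ} (hε : 0 < ε) {p : ℝ → ℝ} (hp : IsTestFn p)
    (hp₀ : ∀ x, 0 ≤ p x) :
    ∃ K, ∀ᶠ n : ℕ in atTop, ∀ x,
      gen H ε p x - K * (n : ℝ)⁻¹ ^ 2 ≤ gen H ε (fun y => p y * bump ((n : ℝ)⁻¹ * y)) x := by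
  obtain ⟨F, hF⟩ := hp.exists_abs_le
  obtain ⟨B, hB₀, hB⟩ := hH.exists_gen_bump_ge hε
  obtain ⟨R, hR⟩ := hp.hasCompactSupport_deriv.isCompact.isBounded.subset_ball 0
  have hF₀ : 0 ≤ F := (abs_nonneg _).trans (hF 0)
  refine ⟨F * B, ?_⟩
  filter_upwards [eventually_ge_atTop 1, eventually_ge_atTop ⌈R⌉₊] with n hn hnR x
  have hn₁ : (1 : ℝ) ≤ n := Nat.one_le_cast.2 hn
  have hR' : R ≤ n := (Nat.le_ceil R).trans (Nat.cast_le.2 hnR)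
  have hχ : ContDiff ℝ 2 fun y => bump ((n : ℝ)⁻¹ * y) :=
    contDiff_bump.comp (contDiff_const.mul contDiff_id)
  rcases lt_or_ge |x| n with hx | hx
  · have hx₁ : |(n : ℝ)⁻¹ * x| < 1 := by
      rwa [abs_mul, abs_inv, Nat.abs_cast, inv_mul_lt_one₀ (zero_lt_one.trans_le hn₁)]
    rw [gen_mul_bump_eq H ε p hx₁, sub_le_self_iff]
    positivity
  · have hx' : x ∉ tsupport (deriv p) := fun hmem => by
      have := mem_ball_zero_iff.1 (hR hmem)
      rw [Real.norm_eq_abs] at this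
      linarith
    have h₁ : deriv p x = 0 := image_eq_zero_of_notMem_tsupport hx'
    have h₂ : deriv (deriv p) x = 0 :=
      image_eq_zero_of_notMem_tsupport fun h => hx' (tsupport_deriv_subset h)
    have hχx := hB (n : ℝ)⁻¹ x (hn₁.trans hx)
    have hgen : gen H ε p x = 0 := by simp [gen, h₁, h₂]
    rw [gen_mul H ε hp.contDiff hχ, hgen, h₁]
    have hpF := mul_le_mul_of_nonneg_right (le_of_abs_le (hF x)) (by positivity :
      0 ≤ B * (n : ℝ)⁻¹ ^ 2)
    linarith [mul_le_mul_of_nonneg_left hχx (hp₀ x)]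

end IsDoubleWell

namespace IsSolution

variable {H : ℝ → ℝ} {ε : ℝ} {ρ : ℝ → ProbDensity} {ρ₀ : ProbDensity}
  (hρ : IsSolution H ε ρ ρ₀)
include hρ

theorem intervalIntegrable_integral_law {q : ℝ → ℝ} (hq : Continuous q)
    (hqs : HasCompactSupport q) {s t : ℝ} (hs : 0 < s) (hst : s ≤ t) :
    IntervalIntegrable (fun r => ∫ x, q x ∂((ρ r).law : Measure ℝ)) volume s t := by
  refine ((hρ.continuousOn_integral_law hq hqs).mono fun r hr => ?_).intervalIntegrable
  rw [uIcc_of_le hst] at hr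
  exact hs.trans_le hr.1

theorem integral_gen_sub_le (hH : IsDoubleWell H) (hε : 0 < ε) {p q : ℝ → ℝ} {κ : ℝ}
    (hp : IsTestFn p) (hq : ContDiff ℝ 2 q) (hqs : HasCompactSupport q)
    (h : ∀ x, gen H ε p x - κ ≤ gen H ε q x) {s t : ℝ} (hs : 0 < s) (hst : s ≤ t) :
    (∫ r in s..t, ∫ x, gen H ε p x ∂((ρ r).law : Measure ℝ)) - (t - s) * κ ≤
      (∫ x, q x ∂((ρ t).law : Measure ℝ)) - ∫ x, q x ∂((ρ s).law : Measure ℝ) := by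
  have cp := hH.continuous_gen ε hp.contDiff
  have cq := hH.continuous_gen ε hq
  have sp := hasCompactSupport_gen H ε hp.hasCompactSupport_deriv
  have sq := hasCompactSupport_gen H ε hqs.deriv
  have ip := hρ.intervalIntegrable_integral_law cp sp hs hst
  have iq := hρ.intervalIntegrable_integral_law cq sq hs hst
  rw [← intervalIntegral.integral_eq_sub_of_hasDerivAt (fun r hr =>
      hρ.hasDerivAt_integral_law_of_hasCompactSupport hH hε hq hqs
        (hs.trans_le (uIcc_of_le hst ▸ hr).1)) iq,
    ← smul_eq_mul (t - s), ← intervalIntegral.integral_const,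
    ← intervalIntegral.integral_sub ip intervalIntegrable_const]
  refine intervalIntegral.integral_mono_on hst (ip.sub intervalIntegrable_const) iq fun r _ => ?_
  have jp : Integrable (gen H ε p) ((ρ r).law : Measure ℝ) := cp.integrable_of_hasCompactSupport sp
  have jq : Integrable (gen H ε q) ((ρ r).law : Measure ℝ) := cq.integrable_of_hasCompactSupport sq
  have mono := integral_mono (jp.sub (integrable_const κ)) jq h
  simpa [integral_sub jp (integrable_const κ)] using mono

theorem integral_gen_le_of_nonneg (hH : IsDoubleWell H) (hε : 0 < ε) {p : ℝ → ℝ}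
    (hp : IsTestFn p) (hp₀ : ∀ x, 0 ≤ p x) {s t : ℝ} (hs : 0 < s) (hst : s ≤ t) :
    ∫ r in s..t, ∫ x, gen H ε p x ∂((ρ r).law : Measure ℝ) ≤
      (∫ x, p x ∂((ρ t).law : Measure ℝ)) - ∫ x, p x ∂((ρ s).law : Measure ℝ) := by
  obtain ⟨F, hF⟩ := hp.exists_abs_le
  obtain ⟨K, hK⟩ := hH.exists_gen_mul_bump_ge hε hp hp₀
  have hcut : ∀ n : ℕ, ContDiff ℝ 2 fun x => p x * bump ((n : ℝ)⁻¹ * x) := fun n =>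
    hp.contDiff.mul (contDiff_bump.comp (contDiff_const.mul contDiff_id))
  have hlim : ∀ r, Tendsto
      (fun n : ℕ => ∫ x, p x * bump ((n : ℝ)⁻¹ * x) ∂((ρ r).law : Measure ℝ)) atTop
      (𝓝 (∫ x, p x ∂((ρ r).law : Measure ℝ))) := fun r => by
    refine tendsto_integral_of_dominated_convergence (fun _ => F)
      (fun n => (hcut n).continuous.aestronglyMeasurable) (integrable_const F)
      (fun n => ae_of_all _ fun x => ?_) (ae_of_all _ fun x => ?_)
    · rw [norm_mul, Real.norm_of_nonneg (bump_nonneg _)]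
      exact (mul_le_of_le_one_right (norm_nonneg _) (bump_le_one _)).trans (hF x)
    · simpa using (tendsto_bump_div_natCast x).const_mul (p x)
  have herr : Tendsto (fun n : ℕ => (∫ r in s..t, ∫ x, gen H ε p x ∂((ρ r).law : Measure ℝ)) -
      (t - s) * (K * (n : ℝ)⁻¹ ^ 2)) atTop
      (𝓝 (∫ r in s..t, ∫ x, gen H ε p x ∂((ρ r).law : Measure ℝ))) := by
    simpa using (((tendsto_inv_atTop_nhds_zero_nat.pow 2).const_mul K).const_mul
      (t - s)).const_sub (∫ r in s..t, ∫ x, gen H ε p x ∂((ρ r).law : Measure ℝ))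
  refine le_of_tendsto_of_tendsto herr ((hlim t).sub (hlim s)) ?_
  filter_upwards [hK, eventually_ne_atTop 0] with n hn hn₀
  exact hρ.integral_gen_sub_le hH hε hp (hcut n)
    (hasCompactSupport_bump_comp_mul (inv_ne_zero (Nat.cast_ne_zero.2 hn₀))).mul_left hn hs hst

theorem integral_gen_eq (hH : IsDoubleWell H) (hε : 0 < ε) {f : ℝ → ℝ} (hf : IsTestFn f)
    {s t : ℝ} (hs : 0 < s) (hst : s ≤ t) :
    ∫ r in s..t, ∫ x, gen H ε f x ∂((ρ r).law : Measure ℝ) =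
      (∫ x, f x ∂((ρ t).law : Measure ℝ)) - ∫ x, f x ∂((ρ s).law : Measure ℝ) := by
  obtain ⟨F, hF⟩ := hf.exists_abs_le
  have hint : ∀ r, Integrable f ((ρ r).law : Measure ℝ) := fun r =>
    Integrable.of_bound hf.contDiff.continuous.aestronglyMeasurable F (ae_of_all _ hF)
  have lower := hρ.integral_gen_le_of_nonneg hH hε (hf.const_add F)
    (fun x => by linarith [neg_le_of_abs_le (hF x)]) hs hst
  have upper := hρ.integral_gen_le_of_nonneg hH hε (hf.const_sub F)
    (fun x => by linarith [le_of_abs_le (hF x)]) hs hst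
  simp only [gen_const_add, integral_add (integrable_const F) (hint _), integral_const,
    probReal_univ, one_smul] at lower
  simp only [gen_const_sub, integral_sub (integrable_const F) (hint _), integral_const,
    probReal_univ, one_smul, integral_neg, intervalIntegral.integral_neg] at upper
  linarith

theorem hasDerivAt_integral_law (hH : IsDoubleWell H) (hε : 0 < ε) {f : ℝ → ℝ}
    (hf : IsTestFn f) {t : ℝ} (ht : 0 < t) :
    HasDerivAt (fun t => ∫ x, f x ∂((ρ t).law : Measure ℝ))
      (∫ x, gen H ε f x ∂((ρ t).law : Measure ℝ)) t := by
  have cg := hH.continuous_gen ε hf.contDiff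
  have sg := hasCompactSupport_gen H ε hf.hasCompactSupport_deriv
  have hcont := hρ.continuousOn_integral_law cg sg
  have ftc := (intervalIntegral.integral_hasDerivAt_right
    (hρ.intervalIntegrable_integral_law cg sg (half_pos ht) (half_le_self ht.le))
    (hcont.stronglyMeasurableAtFilter isOpen_Ioi t ht)
    (hcont.continuousAt (Ioi_mem_nhds ht))).const_add (∫ x, f x ∂((ρ (t / 2)).law : Measure ℝ))
  refine ftc.congr_of_eventuallyEq ?_
  filter_upwards [lt_mem_nhds (half_lt_self ht)] with s hs
  rw [hρ.integral_gen_eq hH hε hf (half_pos ht) hs.le]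
  ring

end IsSolution

section ProbabilityMean

variable {α : Type*} [MeasurableSpace α] {μ : Measure α} [IsProbabilityMeasure μ] {f : α → ℝ}
  {A : Set α} {a b : ℝ}

theorem integral_le_add_mul_measureReal (hf : Integrable f μ) (hA : MeasurableSet A)
    (h : ∀ x ∉ A, f x ≤ a) (hA' : ∀ x ∈ A, f x ≤ a + b) :
    ∫ x, f x ∂μ ≤ a + b * μ.real A := by
  have hind : Integrable (A.indicator fun _ => b) μ := (integrable_const b).indicator hA
  have hsum : ∫ x, (a + A.indicator (fun _ => b) x) ∂μ = a + b * μ.real A := by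
    rw [integral_add (integrable_const a) hind, integral_indicator_const b hA]
    simp [mul_comm]
  rw [← hsum]
  refine integral_mono hf ((integrable_const a).add hind) fun x => ?_
  by_cases hx : x ∈ A
  · simpa [hx] using hA' x hx
  · simpa [hx] using h x hx

theorem abs_integral_le_add_mul_measureReal (hf : Integrable f μ) (hA : MeasurableSet A)
    (ha : 0 ≤ a) (h : ∀ x ∉ A, |f x| ≤ a) (hb : ∀ x, |f x| ≤ b) :
    |∫ x, f x ∂μ| ≤ a + b * μ.real A :=
  abs_integral_le_integral_abs.trans <|
    integral_le_add_mul_measureReal hf.abs hA h fun x _ => by linarith [hb x]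

end ProbabilityMean

namespace IsDoubleWell

variable {H : ℝ → ℝ} (hH : IsDoubleWell H)
include hH

theorem deriv_pos {x : ℝ} (hx : 1 < x) : 0 < deriv H x :=
  pos_of_mul_pos_right (hH.deriv_outer x (by rwa [abs_of_pos (by linarith)])) (by linarith)

theorem deriv_neg {x : ℝ} (h₀ : 0 < x) (h₁ : x < 1) : deriv H x < 0 :=
  neg_of_mul_neg_right (hH.deriv_inner x (by rwa [abs_of_pos h₀]) (by rwa [abs_of_pos h₀])) h₀.le

theorem strictMonoOn : StrictMonoOn H (Ici 1) :=
  strictMonoOn_of_deriv_pos (convex_Ici 1) hH.continuous.continuousOn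
    (by rw [interior_Ici]; exact fun x hx => hH.deriv_pos hx)

theorem strictAntiOn : StrictAntiOn H (Icc 0 1) :=
  strictAntiOn_of_deriv_neg (convex_Icc 0 1) hH.continuous.continuousOn
    (by rw [interior_Icc]; exact fun x hx => hH.deriv_neg hx.1 hx.2)

theorem apply_abs (x : ℝ) : H |x| = H x := by
  rcases abs_choice x with h | h <;> rw [h]
  exact hH.even x

theorem pos_of_nonneg {x : ℝ} (h₀ : 0 ≤ x) (h₁ : x ≠ 1) : 0 < H x := by
  rw [← hH.well.1]
  rcases lt_or_gt_of_ne h₁ with h | h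
  · exact hH.strictAntiOn ⟨h₀, h.le⟩ (by simp) h
  · exact hH.strictMonoOn (by simp) h.le h

theorem eq_zero_iff {x : ℝ} : H x = 0 ↔ |x| = 1 := by
  rw [← hH.apply_abs]
  refine ⟨fun h => ?_, fun h => by rw [h, hH.well.1]⟩
  by_contra hx
  exact (hH.pos_of_nonneg (abs_nonneg x) hx).ne' h

theorem eq_zero_or_abs_eq_one_of_deriv_eq_zero {x : ℝ} (hx : deriv H x = 0) :
    x = 0 ∨ |x| = 1 := by
  by_contra! h
  rcases lt_or_gt_of_ne h.2 with h' | h'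
  · simpa [hx] using hH.deriv_inner x (abs_pos.2 h.1) h'
  · simpa [hx] using hH.deriv_outer x h'

theorem measurableSet_superlevel (h : ℝ) : MeasurableSet {x | h ≤ H x} :=
  (isClosed_le continuous_const hH.continuous).measurableSet

end IsDoubleWell

namespace IsSolution

variable {H : ℝ → ℝ} {ε : ℝ} {ρ : ℝ → ProbDensity} {ρ₀ : ProbDensity}
  (hρ : IsSolution H ε ρ ρ₀) (hH : IsDoubleWell H) (hε : 0 < ε) {f : ℝ → ℝ} (hf : IsTestFn f)
include hρ hf

theorem tendsto_integral_law_of_isTestFn :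
    Tendsto (fun t => ∫ x, f x ∂((ρ t).law : Measure ℝ)) (𝓝[>] 0)
      (𝓝 (∫ x, f x ∂(ρ₀.law : Measure ℝ))) := by
  obtain ⟨F, hF⟩ := hf.exists_abs_le
  exact hρ.tendsto_integral_law hf.contDiff.continuous hF

include hH hε

theorem integral_law_le_add_mul {b t : ℝ} (hb : ∀ x, gen H ε f x ≤ b) (ht : 0 < t) :
    ∫ x, f x ∂((ρ t).law : Measure ℝ) ≤ (∫ x, f x ∂(ρ₀.law : Measure ℝ)) + b * t := by
  have h₀ : Tendsto (fun t => (∫ x, f x ∂((ρ t).law : Measure ℝ)) - b * t) (𝓝[>] 0)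
      (𝓝 (∫ x, f x ∂(ρ₀.law : Measure ℝ))) := by
    have hlin : Continuous fun t : ℝ => b * t := by fun_prop
    simpa using (hρ.tendsto_integral_law_of_isTestFn hf).sub
      ((hlin.tendsto 0).mono_left nhdsWithin_le_nhds)
  have hle := le_of_hasDerivAt_nonpos ht (fun s hs =>
    (hρ.hasDerivAt_integral_law hH hε hf hs.1).sub ((hasDerivAt_id s).const_mul b)) h₀
    fun s _ => by
      have hmean := integral_mono (μ := ((ρ s).law : Measure ℝ))
        ((hH.continuous_gen ε hf.contDiff).integrable_of_hasCompactSupport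
          (hasCompactSupport_gen H ε hf.hasCompactSupport_deriv)) (integrable_const b) hb
      simpa using hmean
  simpa using hle

theorem integral_law_le_add_exp_neg_mul {g : ℝ → ℝ} {Λ b t : ℝ} (hΛ : 0 ≤ Λ)
    (hg : ∀ s, Integrable g ((ρ s).law : Measure ℝ))
    (hgen : ∀ x, gen H ε f x ≤ Λ * (g x - f x))
    (hb : ∀ s ∈ Ioc 0 t, ∫ x, g x ∂((ρ s).law : Measure ℝ) ≤ b) (ht : 0 < t) :
    ∫ x, f x ∂((ρ t).law : Measure ℝ) ≤
      b + Real.exp (-(Λ * t)) * ((∫ x, f x ∂(ρ₀.law : Measure ℝ)) - b) := by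
  refine le_add_exp_neg_mul_of_hasDerivAt_le ht
    (fun s hs => hρ.hasDerivAt_integral_law hH hε hf hs.1)
    (hρ.tendsto_integral_law_of_isTestFn hf) fun s hs => ?_
  obtain ⟨F, hF⟩ := hf.exists_abs_le
  have hfi : Integrable f ((ρ s).law : Measure ℝ) :=
    Integrable.of_bound hf.contDiff.continuous.aestronglyMeasurable F (ae_of_all _ hF)
  have hgi : Integrable (gen H ε f) ((ρ s).law : Measure ℝ) :=
    (hH.continuous_gen ε hf.contDiff).integrable_of_hasCompactSupport
      (hasCompactSupport_gen H ε hf.hasCompactSupport_deriv)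
  calc ∫ x, gen H ε f x ∂((ρ s).law : Measure ℝ)
      ≤ ∫ x, Λ * (g x - f x) ∂((ρ s).law : Measure ℝ) :=
        integral_mono hgi (((hg s).sub hfi).const_mul Λ) hgen
    _ = Λ * ((∫ x, g x ∂((ρ s).law : Measure ℝ)) - ∫ x, f x ∂((ρ s).law : Measure ℝ)) := by
        rw [integral_const_mul, integral_sub (hg s) hfi]
    _ ≤ _ := by gcongr; exact hb s hs

end IsSolution

theorem tendsto_inv_sq_atTop : Tendsto (fun ε : ℝ => (ε ^ 2)⁻¹) (𝓝[>] 0) atTop := by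
  simp_rw [← inv_pow]
  exact (tendsto_pow_atTop two_ne_zero).comp tendsto_inv_nhdsGT_zero

theorem tendsto_exp_neg_mul_inv_sq {a : ℝ} (ha : 0 < a) :
    Tendsto (fun ε : ℝ => Real.exp (-(a * (ε ^ 2)⁻¹))) (𝓝[>] 0) (𝓝 0) :=
  Real.tendsto_exp_neg_atTop_nhds_zero.comp (tendsto_inv_sq_atTop.const_mul_atTop ha)

theorem exists_pos_mul_exp_neg_le {B d δ : ℝ} (hd : 0 < d) (hδ : 0 < δ) :
    ∃ a > 0, B * Real.exp (-(a * d)) ≤ δ := by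
  have hlim : Tendsto (fun a : ℝ => B * Real.exp (-(a * d))) atTop (𝓝 0) := by
    simpa using (Real.tendsto_exp_neg_atTop_nhds_zero.comp
      (tendsto_id.atTop_mul_const hd)).const_mul B
  exact ((eventually_gt_atTop 0).and (hlim.eventually_le_const hδ)).exists

theorem inv_tau (ε : ℝ) : (tau ε)⁻¹ = ε ^ 2 * Real.exp (ε ^ 2)⁻¹ := by
  rw [tau, mul_inv, inv_inv, ← Real.exp_neg, neg_div, neg_neg, one_div]

theorem isCompact_sublevel {H : ℝ → ℝ} (hH : Continuous H) (hcoer : Tendsto H (cocompact ℝ) atTop)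
    (M : ℝ) : IsCompact {x | H x ≤ M} := by
  obtain ⟨K, hK, hKM⟩ := mem_cocompact.1 (hcoer.eventually_gt_atTop M)
  refine hK.of_isClosed_subset (isClosed_le hH continuous_const) fun x (hx : H x ≤ M) => ?_
  by_contra hxK
  exact (hKM hxK).not_ge hx

/-- Concentration of a family of probability measures on the wells of `H`: every superlevel set
`{h ≤ H}` with `h > 0` loses its mass in the limit. -/
def ConcentratesOnWells {ι : Type*} (H : ℝ → ℝ) (μ : ι → ProbabilityMeasure ℝ) (l : Filter ι) :
    Prop :=
  ∀ h > 0, Tendsto (fun i => (μ i : Measure ℝ).real {x | h ≤ H x}) l (𝓝 0)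

/-- The factor `H'' - ε⁻² (H')² / 2`, whose sign governs the action of the generator on functions
that increase with `H`. -/
noncomputable def dissip (H : ℝ → ℝ) (ε x : ℝ) : ℝ :=
  deriv (deriv H) x - (ε ^ 2)⁻¹ / 2 * deriv H x ^ 2

/-- A Lyapunov function of class `C²`: it increases with `H` and equals one on `{M ≤ H}`. -/
noncomputable def lyap (H : ℝ → ℝ) (M a x : ℝ) : ℝ :=
  Real.exp (-(a * max (M - H x) 0 ^ 3))

section Lyapunov

variable {H : ℝ → ℝ} {M a : ℝ}

theorem lyap_pos (x : ℝ) : 0 < lyap H M a x := Real.exp_pos _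

theorem lyap_le_one (ha : 0 ≤ a) (x : ℝ) : lyap H M a x ≤ 1 := by
  rw [lyap, Real.exp_le_one_iff, neg_nonpos]
  positivity

theorem lyap_le_exp (ha : 0 ≤ a) {x h : ℝ} (hx : H x ≤ h) (hM : h ≤ M) :
    lyap H M a x ≤ Real.exp (-(a * (M - h) ^ 3)) := by
  rw [lyap, max_eq_left (by linarith)]
  have := sub_nonneg.2 hM
  gcongr

theorem exp_le_lyap (ha : 0 ≤ a) {x h : ℝ} (hx : h ≤ H x) (hM : h ≤ M) :
    Real.exp (-(a * (M - h) ^ 3)) ≤ lyap H M a x := by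
  rw [lyap]
  gcongr
  exact max_le (by linarith) (sub_nonneg.2 hM)

variable (hH : IsDoubleWell H)
include hH

theorem hasDerivAt_lyap (x : ℝ) : HasDerivAt (lyap H M a)
    (lyap H M a x * (3 * a * max (M - H x) 0 ^ 2 * deriv H x)) x := by
  have hpow := (hasDerivAt_max_zero_pow 1 (M - H x)).comp x ((hH.hasDerivAt x).const_sub M)
  refine ((hpow.const_mul a).neg).exp.congr_deriv ?_
  simp only [lyap, Function.comp, Pi.neg_apply]
  push_cast
  ring

theorem deriv_lyap :
    deriv (lyap H M a) = fun x => lyap H M a x * (3 * a * max (M - H x) 0 ^ 2 * deriv H x) :=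
  funext fun x => (hasDerivAt_lyap hH x).deriv

theorem hasDerivAt_deriv_lyap (x : ℝ) : HasDerivAt (deriv (lyap H M a))
    (lyap H M a x * ((3 * a * max (M - H x) 0 ^ 2 * deriv H x) ^ 2 +
      (3 * a * max (M - H x) 0 ^ 2 * deriv (deriv H) x -
        6 * a * max (M - H x) 0 * deriv H x ^ 2))) x := by
  have hpow := (hasDerivAt_max_zero_pow 0 (M - H x)).comp x ((hH.hasDerivAt x).const_sub M)
  rw [deriv_lyap hH]
  refine ((hasDerivAt_lyap hH x).mul
    ((hpow.const_mul (3 * a)).mul (hH.hasDerivAt_deriv x))).congr_deriv ?_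
  simp only [Function.comp, Pi.mul_apply]
  push_cast
  ring

theorem isTestFn_lyap (hcoer : Tendsto H (cocompact ℝ) atTop) : IsTestFn (lyap H M a) where
  contDiff := contDiff_two_of_hasDerivAt (hasDerivAt_lyap hH)
    (fun x => deriv_lyap (M := M) (a := a) hH ▸ hasDerivAt_deriv_lyap hH x) (by
      have h₀ := hH.continuous
      have h₁ := hH.continuous_deriv
      have h₂ := hH.continuous_deriv_deriv
      unfold lyap
      fun_prop)
  hasCompactSupport_deriv :=
    HasCompactSupport.intro (isCompact_sublevel hH.continuous hcoer M) fun x hx => by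
      have hMx : M ≤ H x := (not_le.1 hx).le
      simp [deriv_lyap hH, max_eq_right (sub_nonpos.2 hMx)]

theorem gen_lyap_le (ha : 0 ≤ a) {ε : ℝ} (hε : 0 < ε) (haM : 6 * a * M ^ 2 ≤ (ε ^ 2)⁻¹) (x : ℝ) :
    gen H ε (lyap H M a) x ≤
      (tau ε)⁻¹ * (3 * a * max (M - H x) 0 ^ 2 * lyap H M a x * dissip H ε x) := by
  have hτ := inv_pos.2 (tau_pos hε)
  have hV := lyap_pos (H := H) (M := M) (a := a) x
  rw [gen, (hasDerivAt_deriv_lyap hH x).deriv, (hasDerivAt_lyap hH x).deriv, dissip]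
  set s := max (M - H x) 0 with hs
  have : 0 ≤ s := le_max_right _ _
  have hsM : 6 * a * s ^ 2 ≤ (ε ^ 2)⁻¹ := by
    rcases le_total (M - H x) 0 with h | h
    · rw [hs, max_eq_right h]
      simp only [ne_eq, OfNat.ofNat_ne_zero, not_false_eq_true, zero_pow, mul_zero]
      positivity
    · rw [hs, max_eq_left h]
      refine le_trans ?_ haM
      gcongr
      linarith [hH.nonneg x]
  have quad : 0 ≤ lyap H M a x * (3 * a / 2) * s ^ 2 * deriv H x ^ 2 *
      ((ε ^ 2)⁻¹ - 6 * a * s ^ 2) := mul_nonneg (by positivity) (sub_nonneg.2 hsM)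
  have cross : 0 ≤ lyap H M a x * (6 * a * s * deriv H x ^ 2) := by positivity
  gcongr
  linarith

end Lyapunov

/-- Away from the wells `H''` is negative wherever `H'` vanishes. -/
theorem IsDoubleWell.exists_dissip_le {H : ℝ → ℝ} (hH : IsDoubleWell H)
    (hcoer : Tendsto H (cocompact ℝ) atTop) (M : ℝ) {h : ℝ} (hh : 0 < h) :
    ∃ κ > 0, ∃ K, 0 ≤ K ∧ ∀ᶠ ε in 𝓝[>] 0, ∀ x, H x ≤ M →
      dissip H ε x ≤ K ∧ (h ≤ H x → dissip H ε x ≤ -κ) := by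
  have c₀ := hH.continuous
  have c₁ := hH.continuous_deriv
  have c₂ := hH.continuous_deriv_deriv
  have hM := isCompact_sublevel c₀ hcoer M
  obtain ⟨κ, hκ, hκ₀⟩ := exists_between (neg_pos.2 hH.deriv2_barrier)
  obtain ⟨K, hK⟩ := hM.exists_bound_of_continuousOn c₂.continuousOn
  have hcrit : IsCompact ({x | H x ≤ M} ∩ {x | h ≤ H x ∧ -κ ≤ deriv (deriv H) x}) :=
    hM.inter_right ((isClosed_le continuous_const c₀).inter (isClosed_le continuous_const c₂))
  obtain ⟨m, hm, hmH⟩ := hcrit.exists_forall_le' (f := fun x => deriv H x ^ 2) (a := 0)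
    (by fun_prop) fun x ⟨_, hx, hx₂⟩ => by
      have hne : deriv H x ≠ 0 := fun h₀ => by
        rcases hH.eq_zero_or_abs_eq_one_of_deriv_eq_zero h₀ with rfl | h₁
        · linarith
        · exact (hh.trans_le hx).ne' (hH.eq_zero_iff.2 h₁)
      positivity
  refine ⟨κ, hκ, |K|, abs_nonneg K, ?_⟩
  filter_upwards [tendsto_inv_sq_atTop.eventually_ge_atTop (2 * (|K| + κ) / m)] with ε hε x hx
  rw [div_le_iff₀ hm] at hε
  have hN : 0 ≤ (ε ^ 2)⁻¹ := by positivity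
  have hxK : deriv (deriv H) x ≤ |K| :=
    (le_abs_self _).trans ((hK x hx).trans (le_abs_self _))
  have hsq := mul_nonneg hN (sq_nonneg (deriv H x))
  unfold dissip
  refine ⟨by linarith, fun hxh => ?_⟩
  rcases le_or_gt (-κ) (deriv (deriv H) x) with hx₂ | hx₂
  · linarith [mul_le_mul_of_nonneg_left (hmH x ⟨hx, hxh, hx₂⟩) hN]
  · linarith

section LyapunovEstimates

variable {H : ℝ → ℝ} (hH : IsDoubleWell H) {M a : ℝ} (ha : 0 ≤ a)
include hH ha

section Generator

variable {ε : ℝ} (hε : 0 < ε) (haM : 6 * a * M ^ 2 ≤ (ε ^ 2)⁻¹) {x : ℝ}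
include hε haM

theorem gen_lyap_nonpos (hx : H x ≤ M → dissip H ε x ≤ 0) : gen H ε (lyap H M a) x ≤ 0 := by
  have hτ := inv_pos.2 (tau_pos hε)
  have hV := lyap_pos (H := H) (M := M) (a := a) x
  refine (gen_lyap_le hH ha hε haM x).trans ?_
  rcases le_or_gt (H x) M with h | h
  · exact mul_nonpos_of_nonneg_of_nonpos hτ.le
      (mul_nonpos_of_nonneg_of_nonpos (by positivity) (hx h))
  · simp [max_eq_right (sub_nonpos.2 h.le)]

theorem gen_lyap_le_of_le {h K : ℝ} (hK : 0 ≤ K) (hx : H x ≤ h) (hM : h ≤ M)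
    (hd : dissip H ε x ≤ K) :
    gen H ε (lyap H M a) x ≤
      (tau ε)⁻¹ * (3 * a * M ^ 2 * Real.exp (-(a * (M - h) ^ 3)) * K) := by
  have hτ := inv_pos.2 (tau_pos hε)
  have hV := lyap_pos (H := H) (M := M) (a := a) x
  have hV' := lyap_le_exp ha hx hM
  have hs : max (M - H x) 0 ≤ M :=
    max_le (by linarith [hH.nonneg x]) (by linarith [hH.nonneg x])
  calc gen H ε (lyap H M a) x
      ≤ (tau ε)⁻¹ * (3 * a * max (M - H x) 0 ^ 2 * lyap H M a x * K) := by
        refine (gen_lyap_le hH ha hε haM x).trans ?_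
        gcongr
    _ ≤ _ := by gcongr

theorem gen_lyap_le_neg {m κ : ℝ} (hκ : 0 ≤ κ) (hx : H x ≤ m) (hM : m ≤ M)
    (hd : dissip H ε x ≤ -κ) :
    gen H ε (lyap H M a) x ≤ (tau ε)⁻¹ * (3 * a * (M - m) ^ 2 * κ) * (0 - lyap H M a x) := by
  have hτ := inv_pos.2 (tau_pos hε)
  have hV := lyap_pos (H := H) (M := M) (a := a) x
  have : 0 ≤ M - m := sub_nonneg.2 hM
  have hs : (M - m) ^ 2 ≤ max (M - H x) 0 ^ 2 := by
    gcongr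
    exact le_max_of_le_left (by linarith)
  calc gen H ε (lyap H M a) x
      ≤ (tau ε)⁻¹ * (3 * a * max (M - H x) 0 ^ 2 * lyap H M a x * -κ) := by
        refine (gen_lyap_le hH ha hε haM x).trans ?_
        gcongr
    _ = -((tau ε)⁻¹ * (3 * a * max (M - H x) 0 ^ 2 * lyap H M a x * κ)) := by ring
    _ ≤ -((tau ε)⁻¹ * (3 * a * (M - m) ^ 2 * lyap H M a x * κ)) := by gcongr
    _ = _ := by ring

/-- The three regions `{H ≤ h}`, `{h ≤ H < m}` and `{m ≤ H}` are responsible for the exponential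
term, the damping and the indicator, respectively. -/
theorem gen_lyap_le_damping {h m K κ : ℝ} (hm : h ≤ m) (hM : m < M) (hK : 0 ≤ K) (hκ : 0 < κ)
    (hd : H x ≤ M → dissip H ε x ≤ K ∧ (h ≤ H x → dissip H ε x ≤ -κ)) :
    gen H ε (lyap H M a) x ≤ (tau ε)⁻¹ * (3 * a * (M - m) ^ 2 * κ) *
      ({x | m ≤ H x}.indicator (fun _ => 1) x +
        (K / κ * (M / (M - m)) ^ 2 + 1) * Real.exp (-(a * (M - h) ^ 3)) - lyap H M a x) := by
  have hτ := inv_pos.2 (tau_pos hε)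
  have hMm := sub_pos.2 hM
  have hE := Real.exp_pos (-(a * (M - h) ^ 3))
  have hI : 0 ≤ {x | m ≤ H x}.indicator (fun _ => (1 : ℝ)) x :=
    indicator_nonneg (fun _ _ => zero_le_one) x
  have hKE : 0 ≤ K / κ * (M / (M - m)) ^ 2 * Real.exp (-(a * (M - h) ^ 3)) := by positivity
  rcases le_total (H x) h with hx | hx
  · have hV := lyap_le_exp ha hx (hm.trans hM.le)
    calc gen H ε (lyap H M a) x
        ≤ (tau ε)⁻¹ * (3 * a * M ^ 2 * Real.exp (-(a * (M - h) ^ 3)) * K) :=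
          gen_lyap_le_of_le hH ha hε haM hK hx (hm.trans hM.le) (hd (by linarith)).1
      _ = (tau ε)⁻¹ * (3 * a * (M - m) ^ 2 * κ) *
            (K / κ * (M / (M - m)) ^ 2 * Real.exp (-(a * (M - h) ^ 3))) := by field_simp
      _ ≤ _ := by gcongr; linarith
  rcases lt_or_ge (H x) m with hxm | hxm
  · refine (gen_lyap_le_neg hH ha hε haM hκ.le hxm.le hM.le ((hd (by linarith)).2 hx)).trans ?_
    gcongr
    linarith
  · refine (gen_lyap_nonpos hH ha hε haM fun hxM => ((hd hxM).2 hx).trans (by linarith)).trans ?_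
    have hI₁ : {x | m ≤ H x}.indicator (fun _ => (1 : ℝ)) x = 1 :=
      indicator_of_mem (s := {x | m ≤ H x}) hxm _
    have hV := lyap_le_one (H := H) (M := M) ha x
    exact mul_nonneg (by positivity) (by linarith)

end Generator

section Mean

variable (μ : Measure ℝ) [IsProbabilityMeasure μ]

theorem integrable_lyap : Integrable (lyap H M a) μ := by
  have hc : Continuous (lyap H M a) :=
    continuous_iff_continuousAt.2 fun x => (hasDerivAt_lyap hH x).continuousAt
  refine Integrable.of_bound hc.aestronglyMeasurable 1 (ae_of_all _ fun x => ?_)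
  rw [Real.norm_of_nonneg (lyap_pos x).le]
  exact lyap_le_one ha x

variable {h : ℝ} (hM : h ≤ M)
include hM

theorem integral_lyap_le :
    ∫ x, lyap H M a x ∂μ ≤ Real.exp (-(a * (M - h) ^ 3)) + μ.real {x | h ≤ H x} := by
  simpa using integral_le_add_mul_measureReal (b := 1) (integrable_lyap hH ha μ)
    (hH.measurableSet_superlevel h) (fun x hx => lyap_le_exp ha (not_le.1 hx).le hM)
    fun x _ => by linarith [lyap_le_one (H := H) (M := M) ha x, Real.exp_pos (-(a * (M - h) ^ 3))]

theorem exp_mul_measureReal_le_integral_lyap :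
    Real.exp (-(a * (M - h) ^ 3)) * μ.real {x | h ≤ H x} ≤ ∫ x, lyap H M a x ∂μ := by
  refine le_trans ?_ (mul_meas_ge_le_integral_of_nonneg (ae_of_all _ fun x => (lyap_pos x).le)
    (integrable_lyap hH ha μ) (Real.exp (-(a * (M - h) ^ 3))))
  exact mul_le_mul_of_nonneg_left (measureReal_mono fun x hx => exp_le_lyap ha hx hM)
    (Real.exp_nonneg _)

end Mean

end LyapunovEstimates

namespace IsSolution

section FixedNoise

variable {H : ℝ → ℝ} {ε : ℝ} {ρ : ℝ → ProbDensity} {ρ₀ : ProbDensity}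
  (hρ : IsSolution H ε ρ ρ₀) (hH : IsDoubleWell H) (hcoer : Tendsto H (cocompact ℝ) atTop)
  (hε : 0 < ε) {K t : ℝ} (hK : 0 ≤ K) (ht : 0 < t)
include hρ hH hcoer hε hK ht

/-- The exponent `ε⁻² / 864` is the largest one allowed by `gen_lyap_le`. At height `1 / 2` it gives
the Lyapunov function the size `e^{-3 / (2ε²)}`, which beats the factor `e^{1 / ε²}` in `τ_ε⁻¹`. -/
theorem measureReal_twelve_le (hd : ∀ x, H x ≤ 12 →
      dissip H ε x ≤ K ∧ (1 / 2 ≤ H x → dissip H ε x ≤ 0)) :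
    ((ρ t).law : Measure ℝ).real {x | 12 ≤ H x} ≤
      Real.exp (-(3 / 2 * (ε ^ 2)⁻¹)) + (ρ₀.law : Measure ℝ).real {x | 1 / 2 ≤ H x} +
        K * Real.exp (-(1 / 2 * (ε ^ 2)⁻¹)) * t := by
  set N := (ε ^ 2)⁻¹ with hN
  have hN₀ : 0 < N := by positivity
  have ha : 0 ≤ N / 864 := by positivity
  have haM : 6 * (N / 864) * 12 ^ 2 ≤ (ε ^ 2)⁻¹ := by linarith
  have hexp : Real.exp (-(N / 864 * (12 - 1 / 2) ^ 3)) ≤ Real.exp (-(3 / 2 * N)) :=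
    Real.exp_le_exp.2 (by linarith)
  have hgen : ∀ x, gen H ε (lyap H 12 (N / 864)) x ≤ K * Real.exp (-(1 / 2 * N)) := fun x => by
    rcases le_or_gt (1 / 2) (H x) with hx | hx
    · exact (gen_lyap_nonpos hH ha hε haM fun h => (hd x h).2 hx).trans (by positivity)
    calc gen H ε (lyap H 12 (N / 864)) x
        ≤ (tau ε)⁻¹ *
            (3 * (N / 864) * 12 ^ 2 * Real.exp (-(N / 864 * (12 - 1 / 2) ^ 3)) * K) :=
          gen_lyap_le_of_le hH ha hε haM hK hx.le (by norm_num) (hd x (by linarith)).1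
      _ ≤ (tau ε)⁻¹ * (3 * (N / 864) * 12 ^ 2 * Real.exp (-(3 / 2 * N)) * K) := by
          have := tau_pos hε
          gcongr
      _ = K * (Real.exp N * Real.exp (-(3 / 2 * N))) / 2 := by
          rw [inv_tau, ← hN, hN]
          field_simp
          norm_num
      _ ≤ K * Real.exp (-(1 / 2 * N)) := by
          rw [← Real.exp_add, show N + -(3 / 2 * N) = -(1 / 2 * N) by ring]
          exact half_le_self (by positivity)
  have hmean := hρ.integral_law_le_add_mul hH hε (isTestFn_lyap hH hcoer) hgen ht
  have hmass := exp_mul_measureReal_le_integral_lyap hH ha ((ρ t).law : Measure ℝ)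
    (h := 12) (M := 12) le_rfl
  have hinit := integral_lyap_le hH ha (ρ₀.law : Measure ℝ) (h := 1 / 2) (M := 12) (by norm_num)
  rw [sub_self, zero_pow three_ne_zero, mul_zero, neg_zero, Real.exp_zero, one_mul] at hmass
  linarith

theorem integral_lyap_le_of_measureReal_le {M a h m κ δ : ℝ} (ha : 0 ≤ a)
    (haM : 6 * a * M ^ 2 ≤ (ε ^ 2)⁻¹) (hm : h ≤ m) (hM : m < M) (hκ : 0 < κ)
    (hd : ∀ x, H x ≤ M → dissip H ε x ≤ K ∧ (h ≤ H x → dissip H ε x ≤ -κ))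
    (hfar : ∀ s ∈ Ioc 0 t, ((ρ s).law : Measure ℝ).real {x | m ≤ H x} ≤ δ)
    (hinit : (ρ₀.law : Measure ℝ).real {x | h ≤ H x} ≤ δ) :
    ∫ x, lyap H M a x ∂((ρ t).law : Measure ℝ) ≤
      2 * δ + (K / κ * (M / (M - m)) ^ 2 + 2) * Real.exp (-(a * (M - h) ^ 3)) := by
  set w := Real.exp (-(a * (M - h) ^ 3))
  set Λ := (tau ε)⁻¹ * (3 * a * (M - m) ^ 2 * κ)
  set b := (K / κ * (M / (M - m)) ^ 2 + 1) * w
  have hΛ₀ : 0 ≤ Λ := mul_nonneg (inv_pos.2 (tau_pos hε)).le (by positivity)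
  have hb₀ : 0 ≤ b := by positivity
  have hδ : 0 ≤ δ := measureReal_nonneg.trans hinit
  have hmeas := hH.measurableSet_superlevel m
  have hI : ∀ s, Integrable ({x | m ≤ H x}.indicator fun _ => (1 : ℝ)) ((ρ s).law : Measure ℝ) :=
    fun s => (integrable_const 1).indicator hmeas
  have hmean : ∀ s ∈ Ioc 0 t,
      ∫ x, ({x | m ≤ H x}.indicator (fun _ => 1) x + b) ∂((ρ s).law : Measure ℝ) ≤ δ + b :=
    fun s hs => by
      rw [integral_add (hI s) (integrable_const b), integral_indicator_const _ hmeas]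
      simpa using hfar s hs
  have hV := hρ.integral_law_le_add_exp_neg_mul hH hε (isTestFn_lyap hH hcoer) hΛ₀
    (fun s => (hI s).add (integrable_const b))
    (fun x => gen_lyap_le_damping hH ha hε haM hm hM hK hκ (hd x)) hmean ht
  have hV₀ : 0 ≤ ∫ x, lyap H M a x ∂(ρ₀.law : Measure ℝ) :=
    integral_nonneg fun x => (lyap_pos x).le
  have hV₁ := integral_lyap_le hH ha (ρ₀.law : Measure ℝ) (hm.trans hM.le)
  have hdecay : Real.exp (-(Λ * t)) * ((∫ x, lyap H M a x ∂(ρ₀.law : Measure ℝ)) - (δ + b)) ≤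
      ∫ x, lyap H M a x ∂(ρ₀.law : Measure ℝ) := by
    have he := Real.exp_pos (-(Λ * t))
    have he₁ : Real.exp (-(Λ * t)) ≤ 1 := Real.exp_le_one_iff.2 (by nlinarith)
    nlinarith
  linarith

end FixedNoise

section Uniform

variable {H : ℝ → ℝ} {ρ : ℝ → ℝ → ProbDensity} {ρ₀ : ℝ → ProbDensity}
  (hρ : ∀ᶠ ε in 𝓝[>] 0, IsSolution H ε (ρ ε) (ρ₀ ε)) (hH : IsDoubleWell H)
  (hcoer : Tendsto H (cocompact ℝ) atTop)
  (hρ₀ : ConcentratesOnWells H (fun ε => (ρ₀ ε).law) (𝓝[>] 0)) {T δ : ℝ} (hδ : 0 < δ)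
include hρ hH hcoer hρ₀ hδ

theorem eventually_measureReal_twelve_le : ∀ᶠ ε in 𝓝[>] 0, ∀ t ∈ Ioc 0 T,
    ((ρ ε t).law : Measure ℝ).real {x | 12 ≤ H x} ≤ δ := by
  obtain ⟨κ, hκ, K, hK, hd⟩ := hH.exists_dissip_le hcoer 12 one_half_pos
  have hlim : Tendsto (fun ε : ℝ => Real.exp (-(3 / 2 * (ε ^ 2)⁻¹)) +
      ((ρ₀ ε).law : Measure ℝ).real {x | 1 / 2 ≤ H x} +
        K * Real.exp (-(1 / 2 * (ε ^ 2)⁻¹)) * T) (𝓝[>] 0) (𝓝 0) := by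
    simpa using ((tendsto_exp_neg_mul_inv_sq (by norm_num)).add (hρ₀ _ one_half_pos)).add
      (((tendsto_exp_neg_mul_inv_sq one_half_pos).const_mul K).mul_const T)
  filter_upwards [self_mem_nhdsWithin, hρ, hd, hlim.eventually_le_const hδ]
    with ε hε hsol hdε hsmall t ht
  refine (hsol.measureReal_twelve_le hH hcoer hε hK ht.1 fun x hx =>
    ⟨(hdε x hx).1, fun h => ((hdε x hx).2 h).trans (by linarith)⟩).trans (le_trans ?_ hsmall)
  gcongr
  exact ht.2

theorem eventually_measureReal_superlevel_le {h : ℝ} (hh : 0 < h) : ∀ᶠ ε in 𝓝[>] 0,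
    ∀ t ∈ Icc 0 T, ((ρ ε t).law : Measure ℝ).real {x | h ≤ H x} ≤ δ := by
  wlog hh₁ : h ≤ 1 generalizing h
  · filter_upwards [this one_pos le_rfl] with ε hε t ht
    exact (measureReal_mono fun x (hx : h ≤ H x) => (not_le.1 hh₁).le.trans hx).trans (hε t ht)
  obtain ⟨κ, hκ, K, hK, hd⟩ := hH.exists_dissip_le hcoer 24 (half_pos hh)
  set B := K / κ * (24 / (24 - 12)) ^ 2 + 2
  have hgap : 0 < (24 - h / 2) ^ 3 - (24 - h) ^ 3 :=
    sub_pos.2 (pow_lt_pow_left₀ (by linarith) (by linarith) three_ne_zero)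
  obtain ⟨a, ha, haB⟩ := exists_pos_mul_exp_neg_le (B := B) hgap (half_pos hδ)
  set w := Real.exp (-(a * (24 - h) ^ 3)) with hw
  have hδ' : 0 < δ / 4 * w := by positivity
  filter_upwards [self_mem_nhdsWithin, hρ, hd,
    tendsto_inv_sq_atTop.eventually_ge_atTop (6 * a * 24 ^ 2),
    eventually_measureReal_twelve_le hρ hH hcoer hρ₀ (T := T) hδ',
    (hρ₀ _ (half_pos hh)).eventually_le_const hδ', (hρ₀ _ hh).eventually_le_const hδ]
    with ε hε hsol hdε haε hfar hinit hinit' t ht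
  rcases ht.1.eq_or_lt with rfl | ht₀
  · rwa [hsol.initial]
  have hmean := hsol.integral_lyap_le_of_measureReal_le hH hcoer hε hK ht₀ ha.le haε
    (by linarith) (by norm_num) hκ hdε (fun s hs => hfar s ⟨hs.1, hs.2.trans ht.2⟩) hinit
  have hmass := exp_mul_measureReal_le_integral_lyap hH ha.le ((ρ ε t).law : Measure ℝ)
    (h := h) (M := 24) (by linarith)
  have hsplit : Real.exp (-(a * (24 - h / 2) ^ 3)) =
      w * Real.exp (-(a * ((24 - h / 2) ^ 3 - (24 - h) ^ 3))) := by
    rw [hw, ← Real.exp_add]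
    ring_nf
  refine le_of_mul_le_mul_left (hmass.trans (hmean.trans ?_)) (Real.exp_pos _)
  calc 2 * (δ / 4 * w) + B * Real.exp (-(a * (24 - h / 2) ^ 3))
      = w * (δ / 2 + B * Real.exp (-(a * ((24 - h / 2) ^ 3 - (24 - h) ^ 3)))) := by
        rw [hsplit]
        ring
    _ ≤ w * (δ / 2 + δ / 2) := by gcongr
    _ = w * δ := by rw [add_halves]

end Uniform

end IsSolution

section Concentration

variable {ι : Type*} {l : Filter ι} {H : ℝ → ℝ} {μ : ι → ProbabilityMeasure ℝ}
  {ν : ProbabilityMeasure ℝ} {r : ℝ → ℝ} {b δ : ℝ}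

theorem exists_pos_forall_lt_abs_le (hH : Continuous H) (hH₀ : ∀ x, 0 ≤ H x)
    (hcoer : Tendsto H (cocompact ℝ) atTop) (hr : Continuous r) (hr₀ : ∀ x, H x = 0 → r x = 0)
    (hδ : 0 < δ) : ∃ h > 0, ∀ x, H x < h → |r x| ≤ δ := by
  have hK : IsCompact ({x | H x ≤ 1} ∩ {x | δ ≤ |r x|}) :=
    (isCompact_sublevel hH hcoer 1).inter_right (isClosed_le continuous_const hr.abs)
  have hpos : ∀ x ∈ {x | H x ≤ 1} ∩ {x | δ ≤ |r x|}, 0 < H x := by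
    refine fun x hx => (hH₀ x).lt_of_ne' fun h => ?_
    have : δ ≤ |r x| := hx.2
    rw [hr₀ x h, abs_zero] at this
    exact this.not_gt hδ
  obtain ⟨m, hm, hmK⟩ := hK.exists_forall_le' hH.continuousOn hpos
  refine ⟨min 1 m, by positivity, fun x hx => ?_⟩
  by_contra! h
  exact (hmK x ⟨(hx.trans_le (min_le_left 1 m)).le, h.le⟩).not_gt (hx.trans_le (min_le_right 1 m))

namespace ConcentratesOnWells

theorem tendsto_integral_zero (hμ : ConcentratesOnWells H μ l) (hH : Continuous H)
    (hH₀ : ∀ x, 0 ≤ H x) (hcoer : Tendsto H (cocompact ℝ) atTop) (hr : Continuous r)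
    (hb : ∀ x, |r x| ≤ b) (hr₀ : ∀ x, H x = 0 → r x = 0) :
    Tendsto (fun i => ∫ x, r x ∂(μ i : Measure ℝ)) l (𝓝 0) := by
  rw [tendsto_zero_iff_abs_tendsto_zero]
  refine tendsto_order.2 ⟨fun a ha => .of_forall fun i => ha.trans_le (abs_nonneg _),
    fun δ hδ => ?_⟩
  obtain ⟨h, hh, hrh⟩ := exists_pos_forall_lt_abs_le hH hH₀ hcoer hr hr₀ (half_pos hδ)
  have hlim : Tendsto (fun i => δ / 2 + b * (μ i : Measure ℝ).real {x | h ≤ H x}) l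
      (𝓝 (δ / 2)) := by simpa using ((hμ h hh).const_mul b).const_add (δ / 2)
  filter_upwards [hlim.eventually_lt_const (half_lt_self hδ)] with i hi
  refine (abs_integral_le_add_mul_measureReal ?_ ?_ (half_pos hδ).le
    (fun x hx => hrh x (not_le.1 hx)) hb).trans_lt hi
  · exact .of_bound hr.aestronglyMeasurable b (.of_forall hb)
  · exact (isClosed_le continuous_const hH).measurableSet

theorem ae_eq_zero_of_tendsto [l.NeBot] (hμ : ConcentratesOnWells H μ l) (hH : Continuous H)
    (hH₀ : ∀ x, 0 ≤ H x) (hcoer : Tendsto H (cocompact ℝ) atTop) (hν : Tendsto μ l (𝓝 ν)) :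
    ∀ᵐ x ∂(ν : Measure ℝ), H x = 0 := by
  have hr : Continuous fun x => min 1 (H x) := continuous_const.min hH
  have hr₀ : ∀ x, 0 ≤ min 1 (H x) := fun x => le_min zero_le_one (hH₀ x)
  have hb : ∀ x, |min 1 (H x)| ≤ 1 := fun x => by
    rw [abs_of_nonneg (hr₀ x)]
    exact min_le_left 1 (H x)
  have hlim := ProbabilityMeasure.tendsto_iff_forall_integral_tendsto.1 hν
    (.ofNormedAddCommGroup _ hr 1 hb)
  have hzero := tendsto_nhds_unique hlim
    (hμ.tendsto_integral_zero hH hH₀ hcoer hr hb fun x hx => by simp [hx])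
  have hint : Integrable (fun x => min 1 (H x)) (ν : Measure ℝ) :=
    .of_bound hr.aestronglyMeasurable 1 (.of_forall hb)
  filter_upwards [(integral_eq_zero_iff_of_nonneg hr₀ hint).1 hzero] with x hx
  exact (min_choice 1 (H x)).elim (fun h => absurd (h.symm.trans hx) one_ne_zero)
    fun h => h.symm.trans hx

theorem of_tendsto (hH : Continuous H) (hν : Tendsto μ l (𝓝 ν))
    (hwells : ∀ᵐ x ∂(ν : Measure ℝ), H x = 0) : ConcentratesOnWells H μ l := by
  intro h hh
  have hnull : (ν : Measure ℝ) {x | h ≤ H x} = 0 := by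
    refine measure_mono_null (fun x (hx : h ≤ H x) => ?_) hwells
    exact (hh.trans_le hx).ne'
  have hfrontier : (ν : Measure ℝ) (frontier {x | h ≤ H x}) = 0 :=
    measure_mono_null (isClosed_le continuous_const hH).frontier_subset hnull
  have hlim := ProbabilityMeasure.tendsto_measure_of_null_frontier_of_tendsto' hν hfrontier
  rw [hnull] at hlim
  exact (ENNReal.tendsto_toReal ENNReal.zero_ne_top).comp hlim

end ConcentratesOnWells

end Concentration

section OddPlateau

/-- A cutoff to a neighbourhood of the well `1`: one on `[3/4, 5/4]`, zero off `[1/2, 3/2]`. -/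
noncomputable def plateau (x : ℝ) : ℝ := max 0 (min 1 (2 - 4 * |x - 1|))

/-- The odd extension of `plateau`, a compactly supported continuous function which is `±1` near
the wells `±1`. -/
noncomputable def oddPlateau (x : ℝ) : ℝ := plateau x - plateau (-x)

theorem continuous_plateau : Continuous plateau := by unfold plateau; fun_prop

theorem continuous_oddPlateau : Continuous oddPlateau :=
  continuous_plateau.sub (continuous_plateau.comp continuous_neg)

theorem plateau_nonneg (x : ℝ) : 0 ≤ plateau x := le_max_left _ _

theorem plateau_le_one (x : ℝ) : plateau x ≤ 1 := max_le zero_le_one (min_le_left _ _)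

theorem plateau_eq_one {x : ℝ} (hx : |x - 1| ≤ 1 / 4) : plateau x = 1 := by
  rw [plateau, min_eq_left (by linarith), max_eq_right zero_le_one]

theorem plateau_eq_zero_of_le {x : ℝ} (hx : x ≤ 1 / 2) : plateau x = 0 :=
  max_eq_left ((min_le_right _ _).trans (by linarith [neg_abs_le (x - 1)]))

theorem plateau_eq_zero_of_ge {x : ℝ} (hx : 3 / 2 ≤ x) : plateau x = 0 :=
  max_eq_left ((min_le_right _ _).trans (by linarith [le_abs_self (x - 1)]))

theorem oddPlateau_neg (x : ℝ) : oddPlateau (-x) = -oddPlateau x := by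
  simp [oddPlateau]

theorem oddPlateau_of_nonneg {x : ℝ} (hx : 0 ≤ x) : oddPlateau x = plateau x := by
  rw [oddPlateau, plateau_eq_zero_of_le (by linarith : -x ≤ 1 / 2), sub_zero]

theorem oddPlateau_one : oddPlateau 1 = 1 := by
  rw [oddPlateau_of_nonneg zero_le_one, plateau_eq_one (by norm_num)]

theorem oddPlateau_neg_one : oddPlateau (-1) = -1 := by
  rw [oddPlateau_neg, oddPlateau_one]

theorem abs_oddPlateau_le_one (x : ℝ) : |oddPlateau x| ≤ 1 :=
  abs_sub_le_of_nonneg_of_le (plateau_nonneg x) (plateau_le_one x) (plateau_nonneg _)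
    (plateau_le_one _)

theorem integrable_oddPlateau (μ : Measure ℝ) [IsFiniteMeasure μ] : Integrable oddPlateau μ :=
  .of_bound continuous_oddPlateau.aestronglyMeasurable 1 (.of_forall abs_oddPlateau_le_one)

end OddPlateau

section TwoWells

variable {u : ℝ}

/-- The law which gives mass `u / 2` to the well `1` and the remaining mass to the well `-1`. -/
noncomputable def twoWells (u : ℝ) : Measure ℝ :=
  ENNReal.ofReal (u / 2) • Measure.dirac 1 + ENNReal.ofReal ((2 - u) / 2) • Measure.dirac (-1)

theorem isProbabilityMeasure_twoWells (h₀ : 0 ≤ u) (h₂ : u ≤ 2) :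
    IsProbabilityMeasure (twoWells u) := by
  refine ⟨?_⟩
  simp only [twoWells, Measure.coe_add, Measure.coe_smul, Pi.add_apply, Pi.smul_apply,
    measure_univ, smul_eq_mul, mul_one]
  rw [← ENNReal.ofReal_add (by linarith) (by linarith), ← ENNReal.ofReal_one]
  congr 1
  ring

theorem integral_twoWells (h₀ : 0 ≤ u) (h₂ : u ≤ 2) (f : ℝ → ℝ) :
    ∫ x, f x ∂twoWells u = (f 1 + f (-1)) / 2 + (f 1 - f (-1)) / 2 * (u - 1) := by
  have hint : ∀ a x : ℝ, Integrable f (ENNReal.ofReal a • Measure.dirac x) := fun a x =>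
    (integrable_dirac (by simp)).smul_measure ENNReal.ofReal_ne_top
  rw [twoWells, integral_add_measure (hint _ _) (hint _ _), integral_smul_measure,
    integral_smul_measure, integral_dirac, integral_dirac, ENNReal.toReal_ofReal (by linarith),
    ENNReal.toReal_ofReal (by linarith), smul_eq_mul, smul_eq_mul]
  ring

theorem integral_oddPlateau_of_ae_abs_eq_one {ν : Measure ℝ} [IsProbabilityMeasure ν]
    (hν : ∀ᵐ x ∂ν, |x| = 1) : ∫ x, oddPlateau x ∂ν = 2 * ν.real (Ioi 0) - 1 := by
  have heq : oddPlateau =ᵐ[ν] fun x => (Ioi (0 : ℝ)).indicator (fun _ => 2) x - 1 := by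
    filter_upwards [hν] with x hx
    rcases eq_or_eq_neg_of_abs_eq hx with rfl | rfl
    · rw [oddPlateau_one, indicator_of_mem (by simp)]
      norm_num
    · rw [oddPlateau_neg_one, indicator_of_notMem (by simp)]
      norm_num
  have hint : Integrable ((Ioi (0 : ℝ)).indicator fun _ => (2 : ℝ)) ν :=
    (integrable_const 2).indicator measurableSet_Ioi
  rw [integral_congr_ae heq, integral_sub hint (integrable_const 1),
    integral_indicator_const 2 measurableSet_Ioi, integral_const, probReal_univ, smul_eq_mul,
    one_smul, mul_comm]

end TwoWells

theorem ConcentratesOnWells.exists_tendsto_twoWells {ι : Type*} {l : Filter ι} {H : ℝ → ℝ}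
    {μ : ι → ProbabilityMeasure ℝ} {u : ℝ} (hμ : ConcentratesOnWells H μ l)
    (hH : IsDoubleWell H) (hcoer : Tendsto H (cocompact ℝ) atTop) (h₀ : 0 ≤ u) (h₂ : u ≤ 2)
    (hodd : Tendsto (fun i => ∫ x, oddPlateau x ∂(μ i : Measure ℝ)) l (𝓝 (u - 1))) :
    ∃ ν : ProbabilityMeasure ℝ, (ν : Measure ℝ) = twoWells u ∧ Tendsto μ l (𝓝 ν) := by
  refine ⟨⟨_, isProbabilityMeasure_twoWells h₀ h₂⟩, rfl,
    ProbabilityMeasure.tendsto_iff_forall_integral_tendsto.2 fun φ => ?_⟩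
  change Tendsto _ _ (𝓝 (∫ x, φ x ∂twoWells u))
  rw [integral_twoWells h₀ h₂]
  set α := (φ 1 + φ (-1)) / 2
  set β := (φ 1 - φ (-1)) / 2
  have hlin : Continuous fun x => α + β * oddPlateau x := by
    have := continuous_oddPlateau
    fun_prop
  have hlin_le : ∀ x, |α + β * oddPlateau x| ≤ |α| + |β| := fun x =>
    (abs_add_le _ _).trans <| by
      rw [abs_mul]
      gcongr
      exact mul_le_of_le_one_right (abs_nonneg β) (abs_oddPlateau_le_one x)
  have hr₀ : ∀ x, H x = 0 → φ x - (α + β * oddPlateau x) = 0 := fun x hx => by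
    rcases eq_or_eq_neg_of_abs_eq (hH.eq_zero_iff.1 hx) with rfl | rfl
    · rw [oddPlateau_one]; ring
    · rw [oddPlateau_neg_one]; ring
  have hrem : Tendsto (fun i => ∫ x, (φ x - (α + β * oddPlateau x)) ∂(μ i : Measure ℝ)) l (𝓝 0) :=
    hμ.tendsto_integral_zero hH.continuous hH.nonneg hcoer (φ.continuous.sub hlin)
      (fun x => (abs_sub _ _).trans (add_le_add (φ.norm_coe_le_norm x) (hlin_le x))) hr₀
  have hsum := hrem.add ((hodd.const_mul β).const_add α)
  rw [zero_add] at hsum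
  refine hsum.congr fun i => ?_
  have hlin_int : Integrable (fun x => α + β * oddPlateau x) (μ i : Measure ℝ) :=
    (integrable_const α).add ((integrable_oddPlateau _).const_mul β)
  rw [integral_sub (φ.integrable _) hlin_int, integral_add (integrable_const α)
    ((integrable_oddPlateau _).const_mul β), integral_const_mul, integral_const, probReal_univ,
    one_smul, sub_add_cancel]

section Boltzmann

variable {α : Type*} [MeasurableSpace α] {μ : Measure α} {V : α → ℝ} {A : Set α} {s t h a : ℝ}

theorem setIntegral_exp_neg_mul_le (hs : Integrable (fun x => Real.exp (-(s * V x))) μ)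
    (ht : Integrable (fun x => Real.exp (-(t * V x))) μ) (hst : s ≤ t) (hA : MeasurableSet A)
    (hV : ∀ x ∈ A, h ≤ V x) :
    ∫ x in A, Real.exp (-(t * V x)) ∂μ ≤
      Real.exp (-((t - s) * h)) * ∫ x, Real.exp (-(s * V x)) ∂μ := by
  calc ∫ x in A, Real.exp (-(t * V x)) ∂μ
      ≤ ∫ x in A, Real.exp (-((t - s) * h)) * Real.exp (-(s * V x)) ∂μ := by
        refine setIntegral_mono_on ht.integrableOn (hs.const_mul _).integrableOn hA fun x hx => ?_
        rw [← Real.exp_add, Real.exp_le_exp]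
        linarith [mul_le_mul_of_nonneg_left (hV x hx) (sub_nonneg.2 hst)]
    _ ≤ ∫ x, Real.exp (-((t - s) * h)) * Real.exp (-(s * V x)) ∂μ :=
        setIntegral_le_integral (hs.const_mul _) (.of_forall fun x => by positivity)
    _ = Real.exp (-((t - s) * h)) * ∫ x, Real.exp (-(s * V x)) ∂μ := integral_const_mul _ _

theorem exp_neg_mul_mul_measureReal_le_integral
    (ht : Integrable (fun x => Real.exp (-(t * V x))) μ) (ht₀ : 0 < t) (a : ℝ) :
    Real.exp (-(t * a)) * μ.real {x | V x ≤ a} ≤ ∫ x, Real.exp (-(t * V x)) ∂μ := by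
  have hset : {x | V x ≤ a} = {x | Real.exp (-(t * a)) ≤ Real.exp (-(t * V x))} := by
    ext x
    simp [mul_le_mul_iff_right₀ ht₀]
  rw [hset]
  exact mul_meas_ge_le_integral_of_nonneg (.of_forall fun x => (Real.exp_pos _).le) ht _

theorem setIntegral_mul_le_of_sq {g u : α → ℝ} {δ : ℝ} (hA : MeasurableSet A) (hg₀ : ∀ x, 0 ≤ g x)
    (hg : IntegrableOn g A μ) (hgu : IntegrableOn (fun x => g x * u x) A μ)
    (hgu2 : Integrable (fun x => g x * u x ^ 2) μ) (hδ : 0 < δ) :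
    ∫ x in A, g x * u x ∂μ ≤ δ * (∫ x, g x * u x ^ 2 ∂μ) + δ⁻¹ * ∫ x in A, g x ∂μ := by
  have hyoung : ∀ y : ℝ, y ≤ δ * y ^ 2 + δ⁻¹ := fun y => by
    have h := mul_nonneg (inv_pos.2 hδ).le
      (by nlinarith [sq_nonneg (δ * y - 1 / 2)] : 0 ≤ (δ * y) ^ 2 + 1 - δ * y)
    field_simp at h ⊢
    linarith
  calc ∫ x in A, g x * u x ∂μ
      ≤ ∫ x in A, (δ * (g x * u x ^ 2) + δ⁻¹ * g x) ∂μ := by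
        refine setIntegral_mono_on hgu ((hgu2.integrableOn.const_mul δ).add (hg.const_mul δ⁻¹)) hA
          fun x _ => ?_
        linarith [mul_le_mul_of_nonneg_left (hyoung (u x)) (hg₀ x)]
    _ = δ * (∫ x in A, g x * u x ^ 2 ∂μ) + δ⁻¹ * ∫ x in A, g x ∂μ := by
        rw [integral_add (hgu2.integrableOn.const_mul δ) (hg.const_mul δ⁻¹), integral_const_mul,
          integral_const_mul]
    _ ≤ δ * (∫ x, g x * u x ^ 2 ∂μ) + δ⁻¹ * ∫ x in A, g x ∂μ := by
        gcongr
        · exact .of_forall fun x => mul_nonneg (hg₀ x) (sq_nonneg _)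
        · exact Measure.restrict_le_self

end Boltzmann

theorem ProbDensity.measureReal_law (ρ : ProbDensity) {A : Set ℝ} (hA : MeasurableSet A) :
    (ρ.law : Measure ℝ).real A = ∫ x in A, ρ x := by
  rw [← integral_indicator_one hA, ρ.integral_law, ← integral_indicator hA]
  congr 1 with x
  by_cases hx : x ∈ A <;> simp [hx]

namespace IsDoubleWell

variable {H : ℝ → ℝ} (hH : IsDoubleWell H)
include hH

theorem tendsto_cocompact_atTop {ε : ℝ} (hZ : Integrable fun x : ℝ => Real.exp (-H x / ε ^ 2)) :
    Tendsto H (cocompact ℝ) atTop := by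
  have hunbounded : ∀ M, ∃ R, 1 ≤ R ∧ M < H R := by
    intro M
    by_contra! hM
    have hsub : Ici 1 ⊆ {x | Real.exp (-M / ε ^ 2) ≤ Real.exp (-H x / ε ^ 2)} :=
      fun x (hx : 1 ≤ x) => by
        have := hM x hx
        simp only [mem_ofPred_eq]
        gcongr
    have hfin := (measure_mono hsub).trans_lt (hZ.measure_ge_lt_top (Real.exp_pos _))
    simp at hfin
  have htop : Tendsto H atTop atTop := tendsto_atTop.2 fun M => by
    obtain ⟨R, hR, hMR⟩ := hunbounded M
    filter_upwards [eventually_ge_atTop R] with x hx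
    exact hMR.le.trans (hH.strictMonoOn.monotoneOn hR (hR.trans hx) hx)
  rw [cocompact_eq_atBot_atTop]
  exact .sup ((htop.comp tendsto_neg_atBot_atTop).congr hH.even) htop

theorem measureReal_sublevel_pos (hcoer : Tendsto H (cocompact ℝ) atTop) {a : ℝ} (ha : 0 < a) :
    0 < volume.real {x | H x ≤ a} := by
  have hpos : 0 < volume {x | H x < a} :=
    (isOpen_lt hH.continuous continuous_const).measure_pos volume ⟨1, by simpa [hH.well.1]⟩
  have hsub : {x | H x < a} ⊆ {x | H x ≤ a} := fun x (hx : H x < a) => hx.le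
  exact ENNReal.toReal_pos (hpos.trans_le (measure_mono hsub)).ne'
    (isCompact_sublevel hH.continuous hcoer a).measure_ne_top

theorem tendsto_setIntegral_gam_superlevel {ε₀ h : ℝ} (hε₀ : 0 < ε₀)
    (hZ : ∀ ε ∈ Ioo 0 ε₀, Integrable (fun x : ℝ => Real.exp (-H x / ε ^ 2))) (hh : 0 < h) :
    Tendsto (fun ε => ∫ x in {x | h ≤ H x}, gam H ε x) (𝓝[>] 0) (𝓝 0) := by
  have hmid : ε₀ / 2 ∈ Ioo 0 ε₀ := ⟨half_pos hε₀, half_lt_self hε₀⟩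
  have hexp : ∀ ε x, -H x / ε ^ 2 = -((ε ^ 2)⁻¹ * H x) := fun ε x => by
    rw [neg_div, div_eq_inv_mul]
  have hv : 0 < volume.real {x | H x ≤ h / 2} :=
    hH.measureReal_sublevel_pos (hH.tendsto_cocompact_atTop (hZ _ hmid)) (half_pos hh)
  simp_rw [hexp] at hZ
  set v := volume.real {x | H x ≤ h / 2}
  set s := ((ε₀ / 2) ^ 2)⁻¹
  set I := ∫ x, Real.exp (-(s * H x))
  have hlim := (tendsto_exp_neg_mul_inv_sq (half_pos hh)).const_mul (Real.exp (s * h) * I / v)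
  rw [mul_zero] at hlim
  refine squeeze_zero' (.of_forall fun ε => ?_) ?_ hlim
  · exact integral_nonneg fun x => mul_nonneg
      (inv_nonneg.2 (integral_nonneg fun _ => (Real.exp_pos _).le)) (Real.exp_pos _).le
  filter_upwards [Ioc_mem_nhdsGT (half_pos hε₀)] with ε hε
  have hpos : 0 < ε := hε.1
  have hint := hZ ε ⟨hε.1, hε.2.trans_lt hmid.2⟩
  have hst : s ≤ (ε ^ 2)⁻¹ := by
    exact inv_anti₀ (by positivity) (pow_le_pow_left₀ hpos.le hε.2 2)
  have hnum := setIntegral_exp_neg_mul_le (hZ _ hmid) hint hst (hH.measurableSet_superlevel h)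
    fun x hx => hx
  have hden := exp_neg_mul_mul_measureReal_le_integral hint (by positivity) (h / 2)
  simp only [gam, partitionFn, hexp]
  rw [integral_const_mul, inv_mul_eq_div]
  calc (∫ x in {x | h ≤ H x}, Real.exp (-((ε ^ 2)⁻¹ * H x))) / ∫ x, Real.exp (-((ε ^ 2)⁻¹ * H x))
      ≤ Real.exp (-(((ε ^ 2)⁻¹ - s) * h)) * I / (Real.exp (-((ε ^ 2)⁻¹ * (h / 2))) * v) := by
        gcongr
    _ = Real.exp (s * h) * I / v * Real.exp (-(h / 2 * (ε ^ 2)⁻¹)) := by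
        have hsplit : Real.exp (-(((ε ^ 2)⁻¹ - s) * h)) = Real.exp (s * h) *
            Real.exp (-(h / 2 * (ε ^ 2)⁻¹)) * Real.exp (-((ε ^ 2)⁻¹ * (h / 2))) := by
          rw [← Real.exp_add, ← Real.exp_add]
          ring_nf
        rw [hsplit]
        field_simp

end IsDoubleWell

namespace IsWellPrepared

variable {H : ℝ → ℝ}

theorem setIntegral_le {ε C c δ : ℝ} {ρ₀ : ProbDensity} (hρ₀ : IsWellPrepared H ε C c ρ₀)
    (hε : 0 < ε) (hZ : Integrable fun x : ℝ => Real.exp (-H x / ε ^ 2)) {A : Set ℝ}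
    (hA : MeasurableSet A) (hδ : 0 < δ) :
    ∫ x in A, ρ₀ x ≤ δ * C + δ⁻¹ * ∫ x in A, gam H ε x := by
  have hgam : ∀ x, 0 < gam H ε x := fun x =>
    mul_pos (inv_pos.2 (integral_exp_pos hZ)) (Real.exp_pos _)
  have hmul : ∀ x, gam H ε x * (ρ₀ x / gam H ε x) = ρ₀ x := fun x =>
    mul_div_cancel₀ _ (hgam x).ne'
  obtain ⟨du, -, hint, -, hC⟩ := hρ₀.energy
  have hdu : 0 ≤ ∫ x, gam H ε x * du x ^ 2 / tau ε := integral_nonneg fun x =>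
    div_nonneg (mul_nonneg (hgam x).le (sq_nonneg _)) (tau_pos hε).le
  have hbound := setIntegral_mul_le_of_sq (u := fun x => ρ₀ x / gam H ε x) hA
    (fun x => (hgam x).le) (hZ.const_mul _).integrableOn
    (by simpa only [hmul] using ρ₀.integrable.integrableOn) hint hδ
  simp only [hmul] at hbound
  refine hbound.trans ?_
  gcongr
  linarith

theorem concentratesOnWells {ε₀ C c : ℝ} {ρ₀ : ℝ → ProbDensity} (hH : IsDoubleWell H)
    (hε₀ : 0 < ε₀) (hZ : ∀ ε ∈ Ioo 0 ε₀, Integrable (fun x : ℝ => Real.exp (-H x / ε ^ 2)))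
    (hρ₀ : ∀ ε ∈ Ioo 0 ε₀, IsWellPrepared H ε C c (ρ₀ ε)) :
    ConcentratesOnWells H (fun ε => (ρ₀ ε).law) (𝓝[>] 0) := by
  intro h hh
  refine tendsto_order.2 ⟨fun a ha => .of_forall fun ε => ha.trans_le measureReal_nonneg,
    fun b hb => ?_⟩
  obtain ⟨δ, hδ, hδC⟩ : ∃ δ > 0, δ * C < b := by
    refine ⟨b / (2 * (|C| + 1)), by positivity, ?_⟩
    rw [div_mul_eq_mul_div, div_lt_iff₀ (by positivity)]
    nlinarith [le_abs_self C, abs_nonneg C]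
  have hlim := ((hH.tendsto_setIntegral_gam_superlevel hε₀ hZ hh).const_mul δ⁻¹).const_add (δ * C)
  rw [mul_zero, add_zero] at hlim
  filter_upwards [hlim.eventually_lt_const hδC, Ioo_mem_nhdsGT hε₀] with ε hlt hε
  have hA := hH.measurableSet_superlevel h
  rw [ProbDensity.measureReal_law _ hA]
  exact ((hρ₀ ε hε).setIntegral_le hε.1 (hZ ε hε) hA hδ).trans_lt hlt

end IsWellPrepared

section Laplace

variable {φ φ' : ℝ → ℝ} {a x₀ : ℝ} (hφ : ∀ x, HasDerivAt φ (φ' x) x)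
  (hφ' : HasDerivAt φ' a x₀) (h₀ : φ x₀ = 0) (h₀' : φ' x₀ = 0)
include hφ hφ' h₀ h₀'

theorem tendsto_div_sub_sq : Tendsto (fun x => φ x / (x - x₀) ^ 2) (𝓝[≠] x₀) (𝓝 (a / 2)) := by
  have hsq : ∀ x, HasDerivAt (fun x => (x - x₀) ^ 2) (2 * (x - x₀)) x := fun x => by
    simpa using ((hasDerivAt_id x).sub_const x₀).fun_pow 2
  refine HasDerivAt.lhopital_zero_nhdsNE (.of_forall hφ) (.of_forall hsq) ?_ ?_ ?_ ?_
  · filter_upwards [self_mem_nhdsWithin] with x hx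
    exact mul_ne_zero two_ne_zero (sub_ne_zero.2 hx)
  · simpa [h₀] using (hφ x₀).continuousAt.tendsto.mono_left nhdsWithin_le_nhds
  · simpa using (hsq x₀).continuousAt.tendsto.mono_left nhdsWithin_le_nhds
  · refine (hasDerivAt_iff_tendsto_slope.1 hφ' |>.div_const 2).congr fun x => ?_
    rw [slope_def_field, h₀', sub_zero, div_div, mul_comm]

theorem exists_pos_mul_sub_sq_le {S : Set ℝ} (hS : IsCompact S) (ha : 0 < a)
    (hpos : ∀ x ∈ S, x ≠ x₀ → 0 < φ x) : ∃ κ > 0, ∀ x ∈ S, κ * (x - x₀) ^ 2 ≤ φ x := by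
  set q := Function.update (fun x => φ x / (x - x₀) ^ 2) x₀ (a / 2) with hq
  have hq_cont : Continuous q := continuous_iff_continuousAt.2 fun x => by
    rcases eq_or_ne x x₀ with rfl | hx
    · exact continuousAt_update_same.2 (tendsto_div_sub_sq hφ hφ' h₀ h₀')
    · refine (continuousAt_update_of_ne hx).2 ((hφ x).continuousAt.div ?_ ?_)
      · fun_prop
      · exact pow_ne_zero 2 (sub_ne_zero.2 hx)
  have hq_pos : ∀ x ∈ S, 0 < q x := fun x hx => by
    rcases eq_or_ne x x₀ with rfl | hne
    · simpa [hq] using ha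
    · have := hpos x hx hne
      have := sub_ne_zero.2 hne
      simp only [hq, Function.update_of_ne hne]
      positivity
  obtain ⟨κ, hκ, hκS⟩ := hS.exists_forall_le' hq_cont.continuousOn hq_pos
  refine ⟨κ, hκ, fun x hx => ?_⟩
  rcases eq_or_ne x x₀ with rfl | hne
  · simp [h₀]
  · have hκx := hκS x hx
    have := sub_ne_zero.2 hne
    rwa [hq, Function.update_of_ne hne, le_div_iff₀ (by positivity)] at hκx

theorem tendsto_rescaled (y : ℝ) :
    Tendsto (fun ε => φ (x₀ + ε * y) / ε ^ 2) (𝓝[>] 0) (𝓝 (a / 2 * y ^ 2)) := by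
  rcases eq_or_ne y 0 with rfl | hy
  · simp [h₀]
  have hε : ∀ᶠ ε : ℝ in 𝓝[>] 0, ε ≠ 0 :=
    eventually_mem_nhdsWithin.mono fun ε (h : 0 < ε) => h.ne'
  have hline : Tendsto (fun ε => x₀ + ε * y) (𝓝[>] 0) (𝓝[≠] x₀) := by
    refine tendsto_nhdsWithin_iff.2 ⟨?_, hε.mono fun ε h => by simp [h, hy]⟩
    have hcont : Continuous fun ε => x₀ + ε * y := by fun_prop
    simpa using (hcont.tendsto 0).mono_left nhdsWithin_le_nhds
  refine (((tendsto_div_sub_sq hφ hφ' h₀ h₀').comp hline).mul_const (y ^ 2)).congr' ?_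
  filter_upwards [hε] with ε hε
  simp only [Function.comp_apply, add_sub_cancel_left]
  field_simp

theorem tendsto_laplace {S : Set ℝ} (hS : IsCompact S) (ha : 0 < a)
    (hpos : ∀ x ∈ S, x ≠ x₀ → 0 < φ x) {w w₀ : ℝ → ℝ} (hw : Measurable w) (hw₁ : ∀ x, |w x| ≤ 1)
    (hwS : ∀ x ∉ S, w x = 0)
    (hw₀ : ∀ y ≠ 0, Tendsto (fun ε => w (x₀ + ε * y)) (𝓝[>] 0) (𝓝 (w₀ y))) :
    Tendsto (fun ε : ℝ => ε⁻¹ * ∫ x, w x * Real.exp (-φ x / ε ^ 2)) (𝓝[>] 0)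
      (𝓝 (∫ y, w₀ y * Real.exp (-(a / 2) * y ^ 2))) := by
  obtain ⟨κ, hκ, hκS⟩ := exists_pos_mul_sub_sq_le hφ hφ' h₀ h₀' hS ha hpos
  have hrescale : ∀ᶠ ε : ℝ in 𝓝[>] 0,
      ∫ y, w (x₀ + ε * y) * Real.exp (-φ (x₀ + ε * y) / ε ^ 2) =
        ε⁻¹ * ∫ x, w x * Real.exp (-φ x / ε ^ 2) := by
    filter_upwards [self_mem_nhdsWithin] with ε (hε : 0 < ε)
    rw [Measure.integral_comp_mul_left (fun z => w (x₀ + z) * Real.exp (-φ (x₀ + z) / ε ^ 2)) ε,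
      abs_of_pos (inv_pos.2 hε), smul_eq_mul,
      integral_add_left_eq_self (fun x => w x * Real.exp (-φ x / ε ^ 2)) x₀]
  refine Tendsto.congr' hrescale (tendsto_integral_filter_of_dominated_convergence
    (fun y => Real.exp (-κ * y ^ 2)) (.of_forall fun ε => ?_) ?_ (integrable_exp_neg_mul_sq hκ) ?_)
  · have hφ_meas := (continuous_iff_continuousAt.2 fun x => (hφ x).continuousAt).measurable
    exact Measurable.aestronglyMeasurable (by fun_prop)
  · filter_upwards [self_mem_nhdsWithin] with ε (hε : 0 < ε)
    refine .of_forall fun y => ?_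
    rw [norm_mul, Real.norm_eq_abs, Real.norm_of_nonneg (Real.exp_pos _).le]
    by_cases hy : x₀ + ε * y ∈ S
    · refine (mul_le_of_le_one_left (Real.exp_pos _).le (hw₁ _)).trans ?_
      rw [Real.exp_le_exp, neg_div, neg_mul, neg_le_neg_iff, le_div_iff₀ (by positivity)]
      linarith [hκS _ hy, mul_pow ε y 2, add_sub_cancel_left x₀ (ε * y)]
    · rw [hwS _ hy, abs_zero, zero_mul]
      positivity
  · have hne : ∀ᵐ y : ℝ, y ≠ 0 := by simp [ae_iff]
    filter_upwards [hne] with y hy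
    refine (hw₀ y hy).mul ((Real.continuous_exp.tendsto _).comp ?_)
    simpa only [neg_div, neg_mul] using (tendsto_rescaled hφ hφ' h₀ h₀' y).neg

end Laplace

theorem integral_indicator_one_mul {s : Set ℝ} (hs : MeasurableSet s) (f : ℝ → ℝ) :
    ∫ x, s.indicator (fun _ => 1) x * f x = ∫ x in s, f x := by
  rw [← integral_indicator hs]
  refine integral_congr_ae (.of_forall fun x => ?_)
  by_cases hx : x ∈ s <;> simp [hx]

/-- The mass of `e^{-H/ε²}` near the well `1`. -/
noncomputable def wellMass (H : ℝ → ℝ) (ε : ℝ) : ℝ := ∫ x, plateau x * Real.exp (-H x / ε ^ 2)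

/-- The mass of `e^{(H-1)/ε²}` on the right half of the barrier at `0`. -/
noncomputable def barrierMass (H : ℝ → ℝ) (ε : ℝ) : ℝ :=
  ∫ x in (0 : ℝ)..(1 / 2), Real.exp (-(1 - H x) / ε ^ 2)

/-- The decay rate of `eigen H ε` under the generator, which tends to Kramers' constant. -/
noncomputable def effRate (H : ℝ → ℝ) (ε : ℝ) : ℝ :=
  ((ε ^ 2)⁻¹ * wellMass H ε * barrierMass H ε)⁻¹

namespace IsDoubleWell

variable {H : ℝ → ℝ} (hH : IsDoubleWell H)
include hH

theorem tendsto_wellMass : Tendsto (fun ε => ε⁻¹ * wellMass H ε) (𝓝[>] 0)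
    (𝓝 √(2 * Real.pi / deriv (deriv H) 1)) := by
  have hlim := tendsto_laplace hH.hasDerivAt (hH.hasDerivAt_deriv 1) hH.well.1 hH.deriv_well.1
    isCompact_Icc hH.deriv2_well.1
    (fun x (hx : x ∈ Icc (1 / 2) (3 / 2)) => hH.pos_of_nonneg (by linarith [hx.1]))
    (w₀ := fun _ => 1) continuous_plateau.measurable
    (fun x => by
      rw [abs_of_nonneg (plateau_nonneg x)]
      exact plateau_le_one x)
    (fun x hx => by
      rcases lt_or_ge x (1 / 2) with h | h
      · exact plateau_eq_zero_of_le h.le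
      · exact plateau_eq_zero_of_ge (not_le.1 fun h' => hx ⟨h, h'⟩).le)
    (fun y _ => by
      have hcont : Continuous fun ε => plateau (1 + ε * y) :=
        continuous_plateau.comp (by fun_prop)
      simpa [plateau_eq_one] using (hcont.tendsto 0).mono_left nhdsWithin_le_nhds)
  simp only [one_mul] at hlim
  rwa [integral_gaussian, div_div_eq_mul_div, mul_comm Real.pi] at hlim

theorem tendsto_barrierMass : Tendsto (fun ε => ε⁻¹ * barrierMass H ε) (𝓝[>] 0)
    (𝓝 (√(2 * Real.pi / |deriv (deriv H) 0|) / 2)) := by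
  have hlim := tendsto_laplace (fun x => (hH.hasDerivAt x).const_sub 1) (hH.hasDerivAt_deriv 0).neg
    (by rw [hH.barrier, sub_self]) (by rw [hH.deriv_barrier, neg_zero])
    isCompact_Icc (neg_pos.2 hH.deriv2_barrier)
    (fun x (hx : x ∈ Icc 0 (1 / 2)) hx₀ => by
      rw [sub_pos, ← hH.barrier]
      exact hH.strictAntiOn (by simp) ⟨hx.1, by linarith [hx.2]⟩ (hx.1.lt_of_ne' hx₀))
    (w := (Ioc (0 : ℝ) (1 / 2)).indicator fun _ => 1)
    (w₀ := (Ioi (0 : ℝ)).indicator fun _ => 1)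
    (measurable_const.indicator measurableSet_Ioc)
    (fun x => by
      by_cases hx : x ∈ Ioc (0 : ℝ) (1 / 2)
      · rw [indicator_of_mem hx, abs_one]
      · rw [indicator_of_notMem hx, abs_zero]
        exact zero_le_one)
    (fun x hx => indicator_of_notMem (fun h => hx (Ioc_subset_Icc_self h)) _)
    (fun y hy => by
      refine tendsto_const_nhds.congr' ?_
      rcases hy.lt_or_gt with hy | hy
      · filter_upwards [self_mem_nhdsWithin] with ε (hε : 0 < ε)
        have := mul_neg_of_pos_of_neg hε hy
        simp [hy.le, this.le]
      · filter_upwards [Ioo_mem_nhdsGT (by positivity : 0 < 1 / 2 / y)] with ε hε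
        have := mul_pos hε.1 hy
        have := (lt_div_iff₀ hy).1 hε.2
        rw [indicator_of_mem (mem_Ioi.2 hy), indicator_of_mem (by constructor <;> linarith)])
  simp only [integral_indicator_one_mul measurableSet_Ioc,
    integral_indicator_one_mul measurableSet_Ioi,
    ← intervalIntegral.integral_of_le (by norm_num : (0 : ℝ) ≤ 1 / 2)] at hlim
  rwa [integral_gaussian_Ioi, div_div_eq_mul_div, mul_comm Real.pi,
    ← abs_of_neg hH.deriv2_barrier] at hlim

theorem rate_pos : 0 < rate H := by
  have := hH.deriv2_well.1
  have := hH.deriv2_barrier.ne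
  have := Real.pi_pos
  unfold rate
  positivity

theorem tendsto_effRate : Tendsto (effRate H) (𝓝[>] 0) (𝓝 (rate H)) := by
  have hwell := hH.deriv2_well.1
  have hbarrier := abs_pos.2 hH.deriv2_barrier.ne
  have hrate : √(2 * Real.pi / deriv (deriv H) 1) * (√(2 * Real.pi / |deriv (deriv H) 0|) / 2) =
      (rate H)⁻¹ := by
    have hsq : 2 * Real.pi / deriv (deriv H) 1 * (2 * Real.pi / |deriv (deriv H) 0|) =
        (2 * Real.pi) ^ 2 / (|deriv (deriv H) 0| * deriv (deriv H) 1) := by field_simp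
    rw [mul_div_assoc', ← Real.sqrt_mul (by positivity), hsq, Real.sqrt_div (by positivity),
      Real.sqrt_sq (by positivity), rate]
    field_simp
  have hlim := (hH.tendsto_wellMass.mul hH.tendsto_barrierMass).inv₀
    (by rw [hrate]; exact (inv_pos.2 hH.rate_pos).ne')
  rw [hrate, inv_inv] at hlim
  refine hlim.congr fun ε => ?_
  rw [effRate, ← inv_pow]
  ring_nf

end IsDoubleWell

/-- The flux `∫_y^∞ g e^{-H/ε²}` generated by the odd plateau `g`, whose support lies to the left
of the end point `2` chosen here. -/
noncomputable def fluxTail (H : ℝ → ℝ) (ε y : ℝ) : ℝ :=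
  ∫ s in y..2, oddPlateau s * Real.exp (-H s / ε ^ 2)

section FluxTail

variable {H : ℝ → ℝ} {ε y : ℝ}

theorem fluxTail_of_ge (hy : 3 / 2 ≤ y) : fluxTail H ε y = 0 := by
  refine intervalIntegral.integral_zero_ae (.of_forall fun s hs => ?_)
  have hs' : 3 / 2 ≤ s := (le_min hy (by norm_num)).trans hs.1.le
  rw [oddPlateau_of_nonneg (by linarith), plateau_eq_zero_of_ge hs', zero_mul]

theorem fluxTail_of_le_half (hy : 0 ≤ y) (hy' : y ≤ 1 / 2) : fluxTail H ε y = wellMass H ε := by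
  have hplateau : ∀ s ∈ Ioc y 2, oddPlateau s * Real.exp (-H s / ε ^ 2) =
      plateau s * Real.exp (-H s / ε ^ 2) := fun s hs => by
    rw [oddPlateau_of_nonneg (hy.trans hs.1.le)]
  rw [fluxTail, intervalIntegral.integral_of_le (by linarith),
    setIntegral_congr_fun measurableSet_Ioc hplateau]
  refine setIntegral_eq_integral_of_forall_compl_eq_zero fun x hx => ?_
  rcases le_or_gt x y with h | h
  · rw [plateau_eq_zero_of_le (h.trans hy'), zero_mul]
  · have hx₂ : 2 < x := not_le.1 fun h' => hx ⟨h, h'⟩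
    rw [plateau_eq_zero_of_ge (by linarith), zero_mul]

variable (hH : Continuous H)
include hH

theorem continuous_oddPlateau_mul_exp (ε : ℝ) :
    Continuous fun s => oddPlateau s * Real.exp (-H s / ε ^ 2) := by
  have hg := continuous_oddPlateau
  fun_prop

theorem hasDerivAt_fluxTail (ε y : ℝ) :
    HasDerivAt (fluxTail H ε) (-(oddPlateau y * Real.exp (-H y / ε ^ 2))) y := by
  have hc := continuous_oddPlateau_mul_exp hH ε
  exact intervalIntegral.integral_hasDerivAt_left (hc.intervalIntegrable _ _)
    hc.stronglyMeasurable.stronglyMeasurableAtFilter hc.continuousAt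

theorem fluxTail_neg (heven : Function.Even H) (ε y : ℝ) :
    fluxTail H ε (-y) = fluxTail H ε y := by
  have hc := continuous_oddPlateau_mul_exp hH ε
  have hodd := intervalIntegral.integral_comp_neg (a := -y) (b := y)
    fun s => oddPlateau s * Real.exp (-H s / ε ^ 2)
  simp only [oddPlateau_neg, heven _, neg_mul, intervalIntegral.integral_neg, neg_neg] at hodd
  have hsplit := intervalIntegral.integral_add_adjacent_intervals
    (hc.intervalIntegrable (μ := volume) (-y) y) (hc.intervalIntegrable y 2)
  unfold fluxTail
  linarith

theorem fluxTail_nonneg (heven : Function.Even H) (ε y : ℝ) : 0 ≤ fluxTail H ε y := by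
  wlog hy : 0 ≤ y generalizing y
  · rw [← fluxTail_neg hH heven]
    exact this (-y) (by linarith)
  rcases le_total (3 / 2) y with h | h
  · rw [fluxTail_of_ge h]
  · refine intervalIntegral.integral_nonneg (by linarith) fun s hs => ?_
    rw [oddPlateau_of_nonneg (hy.trans hs.1)]
    exact mul_nonneg (plateau_nonneg s) (Real.exp_nonneg _)

theorem fluxTail_le (hH₀ : ∀ x, 0 ≤ H x) (hy : 0 ≤ y) (hy' : y ≤ 2) : fluxTail H ε y ≤ 2 := by
  have hle : ∀ s ∈ Icc y 2, oddPlateau s * Real.exp (-H s / ε ^ 2) ≤ 1 := fun s hs => by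
    rw [oddPlateau_of_nonneg (hy.trans hs.1)]
    refine mul_le_one₀ (plateau_le_one s) (Real.exp_nonneg _) (Real.exp_le_one_iff.2 ?_)
    rw [neg_div, neg_nonpos]
    exact div_nonneg (hH₀ s) (sq_nonneg ε)
  have hmono := intervalIntegral.integral_mono_on (μ := volume) hy'
    ((continuous_oddPlateau_mul_exp hH ε).intervalIntegrable y 2) intervalIntegrable_const hle
  rw [intervalIntegral.integral_const, smul_eq_mul, mul_one] at hmono
  exact hmono.trans (by linarith)

end FluxTail

/-- The derivative of `eigen H ε`, obtained by integrating `gen H ε f = -effRate H ε * oddPlateau`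
once with the integrating factor `e^{-H/ε²}`. -/
noncomputable def eigenDeriv (H : ℝ → ℝ) (ε y : ℝ) : ℝ :=
  effRate H ε * tau ε * (Real.exp (H y / ε ^ 2) * fluxTail H ε y)

/-- The approximate eigenfunction of the generator: an odd function that equals `1` at `1 / 2` and
is mapped by the generator to `-effRate H ε * oddPlateau`. -/
noncomputable def eigen (H : ℝ → ℝ) (ε x : ℝ) : ℝ := ∫ y in (0 : ℝ)..x, eigenDeriv H ε y

theorem eigenDeriv_of_ge {H : ℝ → ℝ} {ε y : ℝ} (hy : 3 / 2 ≤ y) : eigenDeriv H ε y = 0 := by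
  rw [eigenDeriv, fluxTail_of_ge hy, mul_zero, mul_zero]

theorem eigen_half {H : ℝ → ℝ} {ε : ℝ} (hr : 0 < effRate H ε) : eigen H ε (1 / 2) = 1 := by
  have hbarrier : ∀ y ∈ uIcc (0 : ℝ) (1 / 2), eigenDeriv H ε y =
      effRate H ε * ((ε ^ 2)⁻¹ * wellMass H ε) * Real.exp (-(1 - H y) / ε ^ 2) := fun y hy => by
    rw [uIcc_of_le (by norm_num)] at hy
    have hexp : Real.exp (-(1 - H y) / ε ^ 2) = Real.exp (-1 / ε ^ 2) * Real.exp (H y / ε ^ 2) := by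
      rw [← Real.exp_add]
      ring_nf
    rw [eigenDeriv, fluxTail_of_le_half hy.1 hy.2, tau, hexp]
    ring
  rw [eigen, intervalIntegral.integral_congr hbarrier, intervalIntegral.integral_const_mul,
    mul_assoc, ← barrierMass]
  exact inv_mul_cancel₀ (inv_pos.1 hr).ne'

namespace IsDoubleWell

variable {H : ℝ → ℝ} (hH : IsDoubleWell H)
include hH

section

variable (ε : ℝ)

theorem hasDerivAt_eigenDeriv (y : ℝ) : HasDerivAt (eigenDeriv H ε)
    ((ε ^ 2)⁻¹ * deriv H y * eigenDeriv H ε y - effRate H ε * tau ε * oddPlateau y) y := by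
  have hexp : Real.exp (H y / ε ^ 2) * Real.exp (-H y / ε ^ 2) = 1 := by
    rw [← Real.exp_add, neg_div, add_neg_cancel, Real.exp_zero]
  have hmul := ((((hH.hasDerivAt y).div_const (ε ^ 2)).exp).mul
    (hasDerivAt_fluxTail hH.continuous ε y)).const_mul (effRate H ε * tau ε)
  refine hmul.congr_deriv ?_
  unfold eigenDeriv
  linear_combination -(effRate H ε * tau ε * oddPlateau y) * hexp

theorem continuous_eigenDeriv : Continuous (eigenDeriv H ε) :=
  continuous_iff_continuousAt.2 fun y => (hH.hasDerivAt_eigenDeriv ε y).continuousAt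

theorem hasDerivAt_eigen (x : ℝ) : HasDerivAt (eigen H ε) (eigenDeriv H ε x) x :=
  (hH.continuous_eigenDeriv ε).integral_hasStrictDerivAt 0 x |>.hasDerivAt

theorem eigenDeriv_neg (y : ℝ) : eigenDeriv H ε (-y) = eigenDeriv H ε y := by
  rw [eigenDeriv, eigenDeriv, fluxTail_neg hH.continuous hH.even, hH.even]

theorem eigen_neg (x : ℝ) : eigen H ε (-x) = -eigen H ε x := by
  have hodd := intervalIntegral.integral_comp_neg (a := 0) (b := x) (eigenDeriv H ε)
  simp only [hH.eigenDeriv_neg, neg_zero] at hodd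
  rw [eigen, eigen, hodd, intervalIntegral.integral_symm]

theorem isTestFn_eigen : IsTestFn (eigen H ε) where
  contDiff := by
    have hH' := hH.continuous_deriv
    have hf' := hH.continuous_eigenDeriv ε
    have hg := continuous_oddPlateau
    exact contDiff_two_of_hasDerivAt (hH.hasDerivAt_eigen ε) (hH.hasDerivAt_eigenDeriv ε)
      (by fun_prop)
  hasCompactSupport_deriv := by
    rw [funext fun x => (hH.hasDerivAt_eigen ε x).deriv]
    refine HasCompactSupport.of_support_subset_isCompact
      (isCompact_Icc (a := -(3 / 2)) (b := 3 / 2)) fun x hx => ?_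
    by_contra h
    rw [mem_Icc, ← abs_le, not_le] at h
    refine hx ?_
    rcases abs_choice x with hx' | hx'
    · exact eigenDeriv_of_ge (hx' ▸ h.le)
    · rw [← hH.eigenDeriv_neg]
      exact eigenDeriv_of_ge (hx' ▸ h.le)

variable {ε}

theorem gen_eigen (hε : 0 < ε) (x : ℝ) : gen H ε (eigen H ε) x = -(effRate H ε * oddPlateau x) := by
  have := (tau_pos hε).ne'
  rw [gen, funext fun y => (hH.hasDerivAt_eigen ε y).deriv, (hH.hasDerivAt_eigenDeriv ε x).deriv]
  field_simp
  ring

variable (hε : 0 < ε) (hr : 0 < effRate H ε)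
include hε hr

theorem eigenDeriv_nonneg (y : ℝ) : 0 ≤ eigenDeriv H ε y :=
  mul_nonneg (mul_pos hr (tau_pos hε)).le
    (mul_nonneg (Real.exp_nonneg _) (fluxTail_nonneg hH.continuous hH.even ε y))

theorem monotone_eigen : Monotone (eigen H ε) :=
  monotone_of_hasDerivAt_nonneg (hH.hasDerivAt_eigen ε) (hH.eigenDeriv_nonneg hε hr)

theorem eigen_le (x : ℝ) : eigen H ε x ≤ eigen H ε (3 / 2) := by
  rcases le_total x (3 / 2) with hx | hx
  · exact hH.monotone_eigen hε hr hx
  · have hzero : ∫ y in (3 / 2 : ℝ)..x, eigenDeriv H ε y = 0 :=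
      intervalIntegral.integral_zero_ae (.of_forall fun y hy =>
        eigenDeriv_of_ge ((uIoc_of_le hx ▸ hy).1.le))
    have hc := hH.continuous_eigenDeriv ε
    rw [eigen, ← intervalIntegral.integral_add_adjacent_intervals
      (hc.intervalIntegrable 0 (3 / 2)) (hc.intervalIntegrable _ x), hzero, add_zero, eigen]

theorem abs_eigen_le (x : ℝ) : |eigen H ε x| ≤ eigen H ε (3 / 2) := by
  refine abs_le.2 ⟨?_, hH.eigen_le hε hr x⟩
  rw [neg_le, ← hH.eigen_neg]
  exact hH.eigen_le hε hr (-x)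

theorem one_le_eigen {x : ℝ} (hx : 1 / 2 ≤ x) : 1 ≤ eigen H ε x :=
  (eigen_half hr).symm.trans_le (hH.monotone_eigen hε hr hx)

theorem abs_eigen_sub_oddPlateau_le {x : ℝ} (hx : |(|x| - 1)| ≤ 1 / 4) :
    |eigen H ε x - oddPlateau x| ≤ eigen H ε (3 / 2) - 1 := by
  wlog h₀ : 0 ≤ x generalizing x
  · have hneg := this (x := -x) (by rwa [abs_neg]) (by linarith)
    rwa [hH.eigen_neg, oddPlateau_neg, neg_sub_neg, abs_sub_comm] at hneg
  rw [abs_of_nonneg h₀] at hx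
  rw [oddPlateau_of_nonneg h₀, plateau_eq_one hx, abs_of_nonneg]
  · exact sub_le_sub_right (hH.eigen_le hε hr x) 1
  · exact sub_nonneg.2 (hH.one_le_eigen hε hr (by linarith [(abs_le.1 hx).1]))

theorem eigen_three_halves_le {M : ℝ} (hM : ∀ y ∈ Icc (1 / 2) (3 / 2), H y ≤ M) :
    eigen H ε (3 / 2) ≤
      1 + 2 * effRate H ε * ((ε ^ 2)⁻¹ * Real.exp (-(1 - M) * (ε ^ 2)⁻¹)) := by
  have hle : ∀ y ∈ Icc (1 / 2) (3 / 2),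
      eigenDeriv H ε y ≤ effRate H ε * tau ε * (Real.exp (M / ε ^ 2) * 2) := fun y hy => by
    have hτ := tau_pos hε
    have hflux := fluxTail_le hH.continuous hH.nonneg (ε := ε) (by linarith [hy.1])
      (by linarith [hy.2] : y ≤ 2)
    have hflux₀ := fluxTail_nonneg hH.continuous hH.even ε y
    have hHM := hM y hy
    unfold eigenDeriv
    gcongr
  have hc := hH.continuous_eigenDeriv ε
  have hmono := intervalIntegral.integral_mono_on (μ := volume) (by norm_num)
    (hc.intervalIntegrable _ _) intervalIntegrable_const hle
  have hexp : Real.exp (-(1 - M) * (ε ^ 2)⁻¹) = Real.exp (-1 / ε ^ 2) * Real.exp (M / ε ^ 2) := by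
    rw [← Real.exp_add]
    ring_nf
  have hhalf := eigen_half hr
  rw [eigen] at hhalf ⊢
  rw [← intervalIntegral.integral_add_adjacent_intervals (hc.intervalIntegrable 0 (1 / 2))
    (hc.intervalIntegrable _ (3 / 2)), hhalf, hexp]
  refine add_le_add_right (hmono.trans_eq ?_) 1
  rw [intervalIntegral.integral_const, smul_eq_mul, tau]
  ring

end

theorem exists_lt_one_forall_le : ∃ M < 1, ∀ y ∈ Icc (1 / 2 : ℝ) (3 / 2), H y ≤ M := by
  obtain ⟨x, hx, hmax⟩ := (isCompact_Icc (a := (1 / 2 : ℝ)) (b := 3 / 2)).exists_isMaxOn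
    (nonempty_Icc.2 (by norm_num)) hH.continuous.continuousOn
  refine ⟨H x, ?_, hmax⟩
  rcases le_total x 1 with h | h
  · rw [← hH.barrier]
    exact hH.strictAntiOn (by simp) ⟨by linarith [hx.1], h⟩ (by linarith [hx.1])
  · rw [← hH.at_two.1]
    exact hH.strictMonoOn h (mem_Ici.2 one_le_two) (by linarith [hx.2])

theorem eventually_effRate_pos : ∀ᶠ ε in 𝓝[>] 0, 0 < effRate H ε :=
  hH.tendsto_effRate.eventually_const_lt hH.rate_pos

theorem tendsto_eigen_three_halves : Tendsto (fun ε => eigen H ε (3 / 2)) (𝓝[>] 0) (𝓝 1) := by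
  obtain ⟨M, hM₁, hM⟩ := hH.exists_lt_one_forall_le
  have hexp : Tendsto (fun ε : ℝ => (ε ^ 2)⁻¹ * Real.exp (-(1 - M) * (ε ^ 2)⁻¹)) (𝓝[>] 0)
      (𝓝 0) := by
    have hlim := tendsto_rpow_mul_exp_neg_mul_atTop_nhds_zero 1 (1 - M) (sub_pos.2 hM₁)
    simp only [Real.rpow_one] at hlim
    exact hlim.comp tendsto_inv_sq_atTop
  have hbound := ((hH.tendsto_effRate.const_mul 2).mul hexp).const_add 1
  rw [mul_zero, add_zero] at hbound
  refine tendsto_of_tendsto_of_tendsto_of_le_of_le' tendsto_const_nhds hbound ?_ ?_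
  · filter_upwards [eventually_mem_nhdsWithin, hH.eventually_effRate_pos] with ε hε hr
    exact hH.one_le_eigen hε hr (by norm_num)
  · filter_upwards [eventually_mem_nhdsWithin, hH.eventually_effRate_pos] with ε hε hr
    exact hH.eigen_three_halves_le hε hr hM

end IsDoubleWell

section Relaxation

variable {H : ℝ → ℝ} (hH : IsDoubleWell H) (hcoer : Tendsto H (cocompact ℝ) atTop)
  {ρ : ℝ → ℝ → ProbDensity} {ρ₀ : ℝ → ProbDensity}
  (hρ : ∀ᶠ ε in 𝓝[>] 0, IsSolution H ε (ρ ε) (ρ₀ ε))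
  (hρ₀ : ConcentratesOnWells H (fun ε => (ρ₀ ε).law) (𝓝[>] 0))
include hH

theorem IsDoubleWell.integrable_eigen (ε : ℝ) (μ : Measure ℝ) [IsFiniteMeasure μ] :
    Integrable (eigen H ε) μ := by
  have hf := hH.isTestFn_eigen ε
  obtain ⟨F, hF⟩ := hf.exists_abs_le
  exact .of_bound hf.contDiff.continuous.aestronglyMeasurable F (.of_forall hF)

theorem IsSolution.hasDerivAt_integral_eigen {ε : ℝ} (hε : 0 < ε)
    (hρε : IsSolution H ε (ρ ε) (ρ₀ ε)) {t : ℝ} (ht : 0 < t) :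
    HasDerivAt (fun t => ∫ x, eigen H ε x ∂((ρ ε t).law : Measure ℝ))
      (-(effRate H ε * ∫ x, oddPlateau x ∂((ρ ε t).law : Measure ℝ))) t := by
  have hderiv := hρε.hasDerivAt_integral_law hH hε (hH.isTestFn_eigen ε) ht
  simpa only [hH.gen_eigen hε, integral_neg, integral_const_mul] using hderiv

include hcoer hρ hρ₀

theorem IsSolution.concentratesOnWells {t : ℝ} (ht : 0 ≤ t) :
    ConcentratesOnWells H (fun ε => (ρ ε t).law) (𝓝[>] 0) := by
  refine fun h hh => tendsto_order.2 ⟨fun a ha => .of_forall fun ε => ?_, fun a ha => ?_⟩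
  · exact ha.trans_le measureReal_nonneg
  · filter_upwards [IsSolution.eventually_measureReal_superlevel_le hρ hH hcoer hρ₀ (half_pos ha)
      hh] with ε hε
    exact (hε t ⟨ht, le_rfl⟩).trans_lt (half_lt_self ha)

theorem IsSolution.eventually_abs_integral_eigen_sub_le (T : ℝ) {δ : ℝ} (hδ : 0 < δ) :
    ∀ᶠ ε in 𝓝[>] 0, ∀ t ∈ Icc 0 T, |(∫ x, eigen H ε x ∂((ρ ε t).law : Measure ℝ)) -
      ∫ x, oddPlateau x ∂((ρ ε t).law : Measure ℝ)| ≤ δ := by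
  obtain ⟨h, hh, hnear⟩ := exists_pos_forall_lt_abs_le hH.continuous hH.nonneg hcoer
    (r := fun x => |x| - 1) (by fun_prop) (fun x hx => sub_eq_zero.2 (hH.eq_zero_iff.1 hx))
    (by norm_num : (0 : ℝ) < 1 / 4)
  have hfar : ∀ᶠ ε in 𝓝[>] 0, eigen H ε (3 / 2) < 1 + min 1 (δ / 2) :=
    hH.tendsto_eigen_three_halves.eventually_lt_const (by simpa using hδ)
  filter_upwards [eventually_mem_nhdsWithin, hH.eventually_effRate_pos, hfar,
    IsSolution.eventually_measureReal_superlevel_le hρ hH hcoer hρ₀ (T := T)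
      (by positivity : 0 < δ / 6) hh] with ε hε hr hfar hmass t ht
  have hfar₁ := min_le_left 1 (δ / 2)
  have hfar₂ := min_le_right 1 (δ / 2)
  have hf := hH.integrable_eigen ε ((ρ ε t).law : Measure ℝ)
  have hg := integrable_oddPlateau ((ρ ε t).law : Measure ℝ)
  rw [← integral_sub hf hg]
  refine (abs_integral_le_add_mul_measureReal (a := δ / 2) (b := 3) (hf.sub hg)
    (hH.measurableSet_superlevel h) (by positivity) (fun x hx => ?_) fun x => ?_).trans ?_
  · exact (hH.abs_eigen_sub_oddPlateau_le hε hr (hnear x (not_le.1 hx))).trans (by linarith)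
  · exact (abs_sub _ _).trans
      (by linarith [hH.abs_eigen_le hε hr x, abs_oddPlateau_le_one x])
  · linarith [hmass t ht]

theorem IsSolution.eventually_abs_integral_oddPlateau_sub_le {t : ℝ} (ht : 0 ≤ t) {δ : ℝ}
    (hδ : 0 < δ) :
    ∀ᶠ ε in 𝓝[>] 0, |(∫ x, oddPlateau x ∂((ρ ε t).law : Measure ℝ)) -
      Real.exp (-(effRate H ε * t)) * ∫ x, oddPlateau x ∂((ρ₀ ε).law : Measure ℝ)| ≤ δ := by
  filter_upwards [eventually_mem_nhdsWithin, hH.eventually_effRate_pos, hρ,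
    IsSolution.eventually_abs_integral_eigen_sub_le hH hcoer hρ hρ₀ t (by positivity : 0 < δ / 3)]
    with ε hε hr hρε hclose
  rcases ht.eq_or_lt with rfl | ht
  · simpa [hρε.initial] using hδ.le
  have hdecay := abs_sub_exp_neg_mul_le ht hr.le
    (fun s hs => hρε.hasDerivAt_integral_eigen hH hε hs.1)
    (hρε.tendsto_integral_law_of_isTestFn (hH.isTestFn_eigen ε))
    fun s hs => hclose s ⟨hs.1.le, hs.2⟩
  have hclose₀ := hclose 0 ⟨le_rfl, ht.le⟩
  rw [hρε.initial] at hclose₀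
  have hexp : |Real.exp (-(effRate H ε * t))| ≤ 1 := by
    rw [abs_of_pos (Real.exp_pos _), Real.exp_le_one_iff, neg_nonpos]
    positivity
  set g := fun μ : ProbabilityMeasure ℝ => ∫ x, oddPlateau x ∂(μ : Measure ℝ)
  set f := fun μ : ProbabilityMeasure ℝ => ∫ x, eigen H ε x ∂(μ : Measure ℝ)
  set E := Real.exp (-(effRate H ε * t))
  calc |g (ρ ε t).law - E * g (ρ₀ ε).law|
      = |-(f (ρ ε t).law - g (ρ ε t).law) + (f (ρ ε t).law - E * f (ρ₀ ε).law) +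
          E * (f (ρ₀ ε).law - g (ρ₀ ε).law)| := by ring_nf
    _ ≤ δ / 3 + δ / 3 + 1 * (δ / 3) := by
        refine (abs_add_three _ _ _).trans (add_le_add_three ?_ hdecay ?_)
        · rw [abs_neg]
          exact hclose t ⟨ht.le, le_rfl⟩
        · rw [abs_mul]
          exact mul_le_mul hexp hclose₀ (abs_nonneg _) zero_le_one
    _ = δ := by ring

theorem IsSolution.tendsto_integral_oddPlateau {m : ℝ}
    (hm : Tendsto (fun ε => ∫ x, oddPlateau x ∂((ρ₀ ε).law : Measure ℝ)) (𝓝[>] 0) (𝓝 m))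
    {t : ℝ} (ht : 0 ≤ t) :
    Tendsto (fun ε => ∫ x, oddPlateau x ∂((ρ ε t).law : Measure ℝ)) (𝓝[>] 0)
      (𝓝 (Real.exp (-(rate H * t)) * m)) := by
  have hexp : Tendsto (fun ε => Real.exp (-(effRate H ε * t))) (𝓝[>] 0)
      (𝓝 (Real.exp (-(rate H * t)))) :=
    (Real.continuous_exp.tendsto _).comp (hH.tendsto_effRate.mul_const t).neg
  refine (tendsto_iff_of_dist (Metric.tendsto_nhds.2 fun δ hδ => ?_)).1 (hexp.mul hm)
  filter_upwards [IsSolution.eventually_abs_integral_oddPlateau_sub_le hH hcoer hρ hρ₀ ht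
    (half_pos hδ)] with ε hε
  rw [dist_zero_right, Real.norm_of_nonneg dist_nonneg, dist_comm]
  exact hε.trans_lt (half_lt_self hδ)

end Relaxation

/-- The limiting trajectory `u`, the solution of `u' = -k (u - 1)` that starts at `2 p`. -/
noncomputable def relaxation (k p t : ℝ) : ℝ := 1 + Real.exp (-(k * t)) * (2 * p - 1)

section RelaxationODE

variable {k p t : ℝ}

theorem relaxation_zero (k p : ℝ) : relaxation k p 0 = 2 * p := by
  simp [relaxation]

theorem hasDerivAt_relaxation (k p t : ℝ) :
    HasDerivAt (relaxation k p) (-k * (relaxation k p t - 1)) t := by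
  have h := ((((hasDerivAt_id t).const_mul k).neg.exp).mul_const (2 * p - 1)).const_add 1
  refine h.congr_deriv ?_
  simp only [Pi.neg_apply, id, relaxation]
  ring

theorem relaxation_mem_Icc (hk : 0 ≤ k) (ht : 0 ≤ t) (hp : p ∈ Icc 0 1) :
    relaxation k p t ∈ Icc 0 2 := by
  have hexp : Real.exp (-(k * t)) ≤ 1 := by
    rw [Real.exp_le_one_iff, neg_nonpos]
    positivity
  have hmul : |Real.exp (-(k * t)) * (2 * p - 1)| ≤ 1 := by
    rw [abs_mul, abs_of_pos (Real.exp_pos _)]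
    exact mul_le_one₀ hexp (abs_nonneg _) (abs_le.2 ⟨by linarith [hp.1], by linarith [hp.2]⟩)
  obtain ⟨h₁, h₂⟩ := abs_le.1 hmul
  constructor <;> (unfold relaxation; linarith)

end RelaxationODE

end Kramers

theorem theorem1_general (H : ℝ → ℝ) (hH : Kramers.IsDoubleWell H)
    (hcoer : Tendsto H (cocompact ℝ) atTop)
    (ρ : ℝ → ℝ → Kramers.ProbDensity) (ρ₀ : ℝ → Kramers.ProbDensity)
    (hρ : ∀ᶠ ε in 𝓝[>] 0, Kramers.IsSolution H ε (ρ ε) (ρ₀ ε))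
    (ρlim : ProbabilityMeasure ℝ)
    (hlim : Tendsto (fun ε => (ρ₀ ε).law) (𝓝[>] 0) (𝓝 ρlim))
    (hwells : ∀ᵐ x ∂(ρlim : Measure ℝ), |x| = 1) :
    ∃ u : ℝ → ℝ,
      u 0 = 2 * (ρlim : Measure ℝ).real (Ioi 0) ∧
      (∀ t, 0 ≤ t →
        HasDerivWithinAt u (-Kramers.rate H * (u t - 1)) (Ici 0) t) ∧
      ∀ t, 0 ≤ t → 0 ≤ u t ∧ u t ≤ 2 ∧
        ∃ ν : ProbabilityMeasure ℝ,
          (ν : Measure ℝ) = ENNReal.ofReal (u t / 2) • Measure.dirac 1 +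
            ENNReal.ofReal ((2 - u t) / 2) • Measure.dirac (-1) ∧
          Tendsto (fun ε => (ρ ε t).law) (𝓝[>] 0) (𝓝 ν) := by
  set p := (ρlim : Measure ℝ).real (Ioi 0)
  have hρ₀ : Kramers.ConcentratesOnWells H (fun ε => (ρ₀ ε).law) (𝓝[>] 0) :=
    .of_tendsto hH.continuous hlim (hwells.mono fun x => hH.eq_zero_iff.2)
  have hodd : Tendsto (fun ε => ∫ x, Kramers.oddPlateau x ∂((ρ₀ ε).law : Measure ℝ)) (𝓝[>] 0)
      (𝓝 (2 * p - 1)) := by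
    rw [← Kramers.integral_oddPlateau_of_ae_abs_eq_one hwells]
    exact ProbabilityMeasure.tendsto_iff_forall_integral_tendsto.1 hlim
      (.ofNormedAddCommGroup _ Kramers.continuous_oddPlateau 1 Kramers.abs_oddPlateau_le_one)
  refine ⟨Kramers.relaxation (Kramers.rate H) p, Kramers.relaxation_zero _ p,
    fun t _ => (Kramers.hasDerivAt_relaxation _ p t).hasDerivWithinAt, fun t ht => ?_⟩
  obtain ⟨hu₀, hu₂⟩ :=
    Kramers.relaxation_mem_Icc (p := p) hH.rate_pos.le ht ⟨measureReal_nonneg, measureReal_le_one⟩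
  refine ⟨hu₀, hu₂, Kramers.ConcentratesOnWells.exists_tendsto_twoWells
    (Kramers.IsSolution.concentratesOnWells hH hcoer hρ hρ₀ ht) hH hcoer hu₀ hu₂ ?_⟩
  rw [Kramers.relaxation, add_sub_cancel_left]
  exact Kramers.IsSolution.tendsto_integral_oddPlateau hH hcoer hρ hρ₀ hodd ht

theorem theorem1 (H : ℝ → ℝ) (hH : Kramers.IsDoubleWell H)
    (ε₀ : ℝ) (hε₀ : 0 < ε₀)
    (hZ : ∀ ε ∈ Ioo 0 ε₀, Integrable (fun x : ℝ => Real.exp (-H x / ε ^ 2)))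
    (ρ : ℝ → ℝ → Kramers.ProbDensity) (ρ₀ : ℝ → Kramers.ProbDensity)
    (hρ : ∀ ε ∈ Ioo 0 ε₀, Kramers.IsSolution H ε (ρ ε) (ρ₀ ε))
    (ρlim : ProbabilityMeasure ℝ)
    (hlim : Tendsto (fun ε => (ρ₀ ε).law) (𝓝[>] 0) (𝓝 ρlim))
    (C c : ℝ) (hc : 0 < c)
    (hprep : ∀ ε ∈ Ioo 0 ε₀, Kramers.IsWellPrepared H ε C c (ρ₀ ε)) :
    ∃ u : ℝ → ℝ,
      u 0 = 2 * (ρlim : Measure ℝ).real (Ioi 0) ∧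
      (∀ t, 0 ≤ t →
        HasDerivWithinAt u (-Kramers.rate H * (u t - 1)) (Ici 0) t) ∧
      ∀ t, 0 ≤ t → 0 ≤ u t ∧ u t ≤ 2 ∧
        ∃ ν : ProbabilityMeasure ℝ,
          (ν : Measure ℝ) = ENNReal.ofReal (u t / 2) • Measure.dirac 1 +
            ENNReal.ofReal ((2 - u t) / 2) • Measure.dirac (-1) ∧
          Tendsto (fun ε => (ρ ε t).law) (𝓝[>] 0) (𝓝 ν) := by
  have hcoer := hH.tendsto_cocompact_atTop (hZ (ε₀ / 2) ⟨half_pos hε₀, half_lt_self hε₀⟩)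
  refine theorem1_general H hH hcoer ρ ρ₀ (eventually_of_mem (Ioo_mem_nhdsGT hε₀) hρ) ρlim hlim ?_
  have hzero := (Kramers.IsWellPrepared.concentratesOnWells hH hε₀ hZ hprep).ae_eq_zero_of_tendsto
    hH.continuous hH.nonneg hcoer hlim
  exact hzero.mono fun x => hH.eq_zero_iff.1
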